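/- Let $\mathfrak g$ be a simple complex Lie algebra of simply-laced type, with Dynkin vertex set $I$, Cartan matrix $C=(c_{ij})$, simple roots $\alpha_i$, simple reflections $s_i$, positive roots $\Phi_+$, $N=\#\Phi_+$, Weyl group $W$ and longest element $w_0$; let $i\mapsto i^*$ be the involution of $I$ with $w_0(\alpha_i)=-\alpha_{i^*}$. Let $Q$ be an orientation of the Dynkin diagram and $\xi:I\to\mathbb Z$ a height function adapted to $Q$, i.e. $\xi(j)=\xi(i)-1$ for every arrow $i\to j$. A word $(i_1,\dots,i_k)$ is adapted to $Q$ if $i_1$ is a source of $Q$, $i_2$ is a source of $s_{i_1}(Q)$, and so on, where $s_i(Q)$ is $Q$ with all arrows at $i$ reversed. Let $\tau_Q\in W$ be the Coxeter element given by a word adapted to $Q$ that contains every vertex exactly once, and let $(i_1,\dots,i_N)$ be a reduced expression of $w_0$ adapted to $Q$, extended to an infinite sequence by $i_{k+Nm}=i_k$ ($m$ even) and $i_{k+Nm}=i_k^*$ ($m$ odd) for $1\le k\le N$, $m\geq 0$. Let $\langle\cdot,\cdot\rangle_Q$ be the bilinear form on $\bigoplus_i\mathbb Z\alpha_i$ with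 $\langle\alpha_i,\alpha_j\rangle_Q=\delta_{ij}-\#\{i\to j \text{ in } Q\}$. Put $I^{\le\xi}=\{(i,p): i\in I,\ p\in\xi(i)+2\mathbb Z_{\le0}\}$, and let $\varphi:I^{\le\xi}\to\mathbb Z_{\ge1}$ be the bijection for which $\varphi(i,p)$ is the position of the $m$-th occurrence of $i$ in $(i_1,i_2,\dots)$, $m=(\xi(i)-p+2)/2$; equivalently $\varphi^{-1}(t)=(i_t,\xi(i_t)-2\,\#\{t'\le t: i_{t'}=i_t\}+2)$. Let $\gamma_j$ be the sum of the $\alpha_i$ such that there is a (possibly trivial) path from $i$ to $j$ in $Q$, and define positive roots $\beta_t$, $t\ge1$, by $\beta_{\varphi(j,\xi(j))}=\gamma_j$ and $\beta_{\varphi(j,s-2)}=\pm\tau_Q(\beta_{\varphi(j,s)})$, with the sign that makes it positive. Let $\tilde C_{ij}(m)$, for $m\ge1$, be the coefficient of $z^m$ in the expansion at $z=0$ of the $(i,j)$ entry of the inverse of the quantum Cartan matrix $C(z)$ ($C_{ii}(z)=z+z^{-1}$, and $C_{ij}(z)=c_{ij}$ for $i\ne j$), and $\tilde C_{ij}(m)=0$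 for $m\le0$. Let $$\widetilde D_\xi:\mathbb C[Y_{i,p}^{\pm1},(i,p)\in I^{\le\xi}]\to\mathbb C(\alpha_i,\,i\in I),\qquad \widetilde D_\xi(Y_{i,p})=\prod_{(j,s)\in I^{\le\xi}}\beta_{\varphi(j,s)}^{\tilde C_{ij}(s-p-1)-\tilde C_{ij}(s-p+1)}$$ (an algebra morphism; the product is finite). Let $\mathcal A^{\le\xi}$ be the Hernandez–Leclerc cluster algebra, with initial cluster $(x_t)_{t\ge1}$ and exchange quiver with vertex set $I^{\le\xi}$ (where $(i,p)$ carries $x_{\varphi(i,p)}$) and an arrow $(i,r)\to(j,s)$ if and only if $c_{ij}\ne0$ and $s=r+c_{ij}$. Let $\iota:\mathcal A^{\le\xi}\to\mathbb C[Y_{i,p}^{\pm1}]$ be the algebra embedding with $\iota(x_{\varphi(i,p)})=Y_{i,p}Y_{i,p+2}\cdots Y_{i,\xi(i)}$ (the truncated $q$-character of the Kirillov–Reshetikhin module $X_{i,p}$). Then for every $t\ge1$ (in particular for $1\le t\le 2N$) there are $n_t(\beta)\in\mathbb N$, $\beta\in\Phi_+$, such that $$\widetilde D_\xi(\iota(x_t))=\prod_{\beta\in\Phi_+}\frac1{\beta^{n_t(\beta)}},$$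 and $n_t(\beta)=|\langle\beta_t,\beta\rangle_Q|$ whenever $n_t(\beta)\ne0$. -/

import Mathlib

open scoped BigOperators

noncomputable section

namespace HL

/-! ## Simply-laced Dynkin data, roots, Weyl group -/

/-- The Cartan matrix of a simple complex Lie algebra of simply-laced type with Dynkin vertex
set `I`: an indecomposable, positive definite, symmetric integer matrix with diagonal entries `2`
and off-diagonal entries in `{0, -1}`. -/
structure SimplyLacedCartan (I : Type*) [Fintype I] where
  C : Matrix I I ℤ
  symm : C.IsSymm
  diag : ∀ i, C i i = 2
  simplyLaced : C.IsSimplyLaced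
  posDef : (C.map (Int.cast : ℤ → ℝ)).PosDef
  connected : (SimpleGraph.fromRel fun i j => C i j = -1).Connected

section Roots

variable {I : Type*} [Fintype I] [DecidableEq I] (D : SimplyLacedCartan I)

/-- The simple root `α_i`, in the root lattice `Γ = ⊕ ℤ α_i`, which is written `I → ℤ`. -/
def simpleRoot (i : I) : I → ℤ := Pi.single i 1

/-- The linear form `x ↦ (α_i, x)` given by the Cartan pairing. -/
def coroot (i : I) : Module.Dual ℤ (I → ℤ) := (LinearMap.proj i).comp (Matrix.mulVecLin D.C)

theorem coroot_simpleRoot (i : I) : coroot D i (simpleRoot i) = 2 := by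
  simp [coroot, simpleRoot, D.diag]

/-- The simple reflection `s_i`, `x ↦ x - (α_i, x) α_i`. -/
def simpleReflection (i : I) : (I → ℤ) ≃ₗ[ℤ] (I → ℤ) :=
  Module.reflection (coroot_simpleRoot D i)

/-- The Weyl group. -/
def weylGroup : Subgroup ((I → ℤ) ≃ₗ[ℤ] (I → ℤ)) :=
  Subgroup.closure (Set.range (simpleReflection D))

/-- The root system `Φ`, the Weyl group orbit of the simple roots. -/
def roots : Set (I → ℤ) := {x | ∃ w ∈ weylGroup D, ∃ i, x = w (simpleRoot i)}

/-- The positive roots `Φ₊ = Φ ∩ ⊕ ℕ α_i`. -/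
def posRoots : Set (I → ℤ) := {x | x ∈ roots D ∧ ∀ i, 0 ≤ x i}

theorem form_reflection (i : I) (x : I → ℤ) :
    simpleReflection D i x ⬝ᵥ (D.C.mulVec (simpleReflection D i x)) = x ⬝ᵥ (D.C.mulVec x) := by
  have h : simpleReflection D i x = x - (D.C.mulVec x i) • (simpleRoot i : I → ℤ) := by
    simp [simpleReflection, Module.reflection_apply, coroot]
  have h1 : (simpleRoot i : I → ℤ) ⬝ᵥ (D.C.mulVec x) = D.C.mulVec x i := by
    simp [simpleRoot]
  have h2 : x ⬝ᵥ (D.C.mulVec (simpleRoot i : I → ℤ)) = D.C.mulVec x i := by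
    rw [Matrix.dotProduct_mulVec, ← Matrix.mulVec_transpose, D.symm.eq]
    simp [simpleRoot]
  have h3 : (simpleRoot i : I → ℤ) ⬝ᵥ (D.C.mulVec (simpleRoot i : I → ℤ)) = 2 := by
    simp [simpleRoot, D.diag]
  rw [h]
  simp only [Matrix.mulVec_sub, Matrix.mulVec_smul, sub_dotProduct, dotProduct_sub,
    smul_dotProduct, dotProduct_smul, h1, h2, h3, smul_eq_mul]
  ring

theorem form_weyl {w : (I → ℤ) ≃ₗ[ℤ] (I → ℤ)} (hw : w ∈ weylGroup D) :
    ∀ x : I → ℤ, w x ⬝ᵥ (D.C.mulVec (w x)) = x ⬝ᵥ (D.C.mulVec x) := by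
  induction hw using Subgroup.closure_induction with
  | mem w hw => obtain ⟨i, rfl⟩ := hw; exact form_reflection D i
  | one => intro x; rfl
  | mul a b _ _ ha hb => intro x; rw [LinearEquiv.mul_apply, ha, hb]
  | inv a _ ha =>
    intro x
    rw [← ha (a⁻¹ x), ← LinearEquiv.mul_apply, mul_inv_cancel]; rfl

theorem form_root {x : I → ℤ} (hx : x ∈ roots D) : x ⬝ᵥ (D.C.mulVec x) = 2 := by
  obtain ⟨w, hw, i, rfl⟩ := hx
  rw [form_weyl D hw]
  simp [simpleRoot, D.diag]

theorem form_bound : ∃ m : ℝ, 0 < m ∧ ∀ x : I → ℝ,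
    m * ‖x‖ ^ 2 ≤ x ⬝ᵥ ((D.C.map (Int.cast : ℤ → ℝ)).mulVec x) := by
  set A := D.C.map (Int.cast : ℤ → ℝ)
  have hcont : Continuous fun x : I → ℝ => x ⬝ᵥ (A.mulVec x) := by fun_prop
  have hpos : ∀ x : I → ℝ, x ≠ 0 → 0 < x ⬝ᵥ (A.mulVec x) := by
    intro x hx
    simpa using D.posDef.dotProduct_mulVec_pos hx
  by_cases hne : (Metric.sphere (0 : I → ℝ) 1).Nonempty
  · obtain ⟨y, hy, hmin⟩ := (isCompact_sphere (0 : I → ℝ) 1).exists_isMinOn hne hcont.continuousOn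
    have hy0 : y ≠ 0 := by
      rintro rfl
      simp at hy
    refine ⟨_, hpos y hy0, fun x => ?_⟩
    by_cases hx : x = 0
    · simp [hx]
    have hn : ‖x‖ ≠ 0 := norm_ne_zero_iff.mpr hx
    have hs : ‖x‖⁻¹ • x ∈ Metric.sphere (0 : I → ℝ) 1 := by
      simp [norm_smul, hn]
    have h := hmin hs
    simp only [Set.mem_ofPred_eq, Matrix.mulVec_smul, smul_dotProduct, dotProduct_smul,
      smul_eq_mul] at h
    calc y ⬝ᵥ (A.mulVec y) * ‖x‖ ^ 2
        ≤ (‖x‖⁻¹ * (‖x‖⁻¹ * x ⬝ᵥ (A.mulVec x))) * ‖x‖ ^ 2 := by gcongr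
      _ = x ⬝ᵥ (A.mulVec x) := by field_simp
  · refine ⟨1, one_pos, fun x => ?_⟩
    by_cases hx : x = 0
    · simp [hx]
    · exact absurd ⟨‖x‖⁻¹ • x, by simp [norm_smul, norm_ne_zero_iff.mpr hx]⟩ hne

theorem finite_roots : (roots D).Finite := by
  obtain ⟨m, hm, hb⟩ := form_bound D
  obtain ⟨B, hB⟩ := exists_nat_gt (2 / m + 1)
  refine (Set.finite_Icc (fun _ : I => -(B : ℤ)) (fun _ => (B : ℤ))).subset fun x hx => ?_
  have h2 := hb (fun i => (x i : ℝ))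
  have h3 : (fun i => (x i : ℝ)) ⬝ᵥ
      ((D.C.map (Int.cast : ℤ → ℝ)).mulVec fun i => (x i : ℝ)) = 2 := by
    have h := form_root D hx
    have h' : ((x ⬝ᵥ (D.C.mulVec x) : ℤ) : ℝ) = 2 := by rw [h]; norm_num
    rw [← h']
    simp [dotProduct, Matrix.mulVec, Matrix.map_apply]
  rw [h3] at h2
  set r := ‖fun i => (x i : ℝ)‖ with hr
  have h4 : r ^ 2 ≤ 2 / m := by rw [le_div_iff₀ hm]; linarith
  have h5 : r < B := by nlinarith [norm_nonneg (fun i => (x i : ℝ)), sq_nonneg (r - 1)]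
  have h6 : ∀ i, |x i| ≤ (B : ℤ) := by
    intro i
    have h7 : |(x i : ℝ)| ≤ r := by
      simpa using norm_le_pi_norm (fun i => (x i : ℝ)) i
    have h8 : |(x i : ℝ)| ≤ (B : ℝ) := by linarith
    exact_mod_cast h8
  exact ⟨fun i => (abs_le.mp (h6 i)).1, fun i => (abs_le.mp (h6 i)).2⟩

instance : Finite (posRoots D) := ((finite_roots D).subset fun _ hx => hx.1).to_subtype

instance : Fintype (posRoots D) := Fintype.ofFinite _

/-- The product `s_{i_1} ⋯ s_{i_k}` of simple reflections along a word. -/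
def wordProd (l : List I) : (I → ℤ) ≃ₗ[ℤ] (I → ℤ) := (l.map (simpleReflection D)).prod

/-- A word of minimal length among the words with the same product. -/
def IsReducedWord (l : List I) : Prop :=
  ∀ l' : List I, wordProd D l' = wordProd D l → l.length ≤ l'.length

/-- `w` is the longest element `w_0` of the Weyl group: the element of `W` with
`w Φ₊ = - Φ₊`. -/
def IsLongestElement (w : (I → ℤ) ≃ₗ[ℤ] (I → ℤ)) : Prop :=
  w ∈ weylGroup D ∧ ∀ x, x ∈ posRoots D ↔ -(w x) ∈ posRoots D

end Roots

/-! ## Quivers, adapted words, the Euler-Ringel form -/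

section Quiver

variable {I : Type*}

/-- `Q i j` means that there is an arrow `i → j`; `Q` orients the Dynkin diagram of `D`. -/
def IsOrientation [Fintype I] (D : SimplyLacedCartan I) (Q : I → I → Prop) : Prop :=
  (∀ i j, Q i j → D.C i j = -1) ∧ ∀ i j, D.C i j = -1 → Xor (Q i j) (Q j i)

/-- A height function adapted to `Q`. -/
def IsHeightFunction (Q : I → I → Prop) (ξ : I → ℤ) : Prop :=
  ∀ i j, Q i j → ξ j = ξ i - 1

def IsSource (Q : I → I → Prop) (i : I) : Prop := ∀ j, ¬ Q j i

/-- `s_i(Q)`: all arrows with source or target `i` are reversed. -/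
def reflectQuiver (Q : I → I → Prop) (i : I) : I → I → Prop :=
  fun a b => ((a = i ∨ b = i) ∧ Q b a) ∨ (¬ (a = i ∨ b = i) ∧ Q a b)

/-- `(i_1, …, i_k)` is adapted to `Q`: `i_1` is a source of `Q`, `i_2` is a source of
`s_{i_1}(Q)`, and so on. -/
def IsAdapted : (I → I → Prop) → List I → Prop
  | _, [] => True
  | Q, i :: l => IsSource Q i ∧ IsAdapted (reflectQuiver Q i) l

/-- A word adapted to `Q` in which every vertex occurs exactly once. The product of its simple
reflections is the Coxeter element `τ_Q`. -/
def IsCoxeterWord (Q : I → I → Prop) (c : List I) : Prop :=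
  c.Nodup ∧ (∀ i, i ∈ c) ∧ IsAdapted Q c

/-- A reduced expression of `w_0` adapted to `Q`. -/
def IsAdaptedLongestWord [Fintype I] [DecidableEq I] (D : SimplyLacedCartan I)
    (Q : I → I → Prop) (w : List I) : Prop :=
  IsReducedWord D w ∧ IsLongestElement D (wordProd D w) ∧ IsAdapted Q w

open Classical in
/-- The Euler-Ringel form, `⟨α_i, α_j⟩_Q = δ_{ij} - #{i → j}`. -/
def eulerForm [Fintype I] (Q : I → I → Prop) (x y : I → ℤ) : ℤ :=
  ∑ i, ∑ j, x i * y j * ((if i = j then 1 else 0) - (if Q i j then 1 else 0))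

open Classical in
/-- `γ_i`, the sum of the `α_j` over the `j` from which there is a path to `i` in `Q`. -/
def gammaRoot (Q : I → I → Prop) (i : I) : I → ℤ :=
  fun j => if Relation.ReflTransGen Q j i then 1 else 0

end Quiver

/-! ## The set `I^{≤ξ}`, the sequence `î_Q`, and the roots `β_t` -/

section Index

variable {I : Type*}

/-- `I^{≤ξ} = {(i, p) | p ∈ ξ(i) + 2 ℤ_{≤ 0}}`. -/
def IndexSet (ξ : I → ℤ) : Type _ := {q : I × ℤ // ∃ k : ℕ, q.2 = ξ q.1 - 2 * (k : ℤ)}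

/-- The element `(i, ξ(i) - 2k)` of `I^{≤ξ}`. -/
def IndexSet.mk (ξ : I → ℤ) (i : I) (k : ℕ) : IndexSet ξ := ⟨(i, ξ i - 2 * (k : ℤ)), k, rfl⟩

/-- The vertex `i` of `(i, p)`. -/
def IndexSet.vertex {ξ : I → ℤ} (q : IndexSet ξ) : I := q.1.1

/-- The second component `p` of `(i, p)`. -/
def IndexSet.pos {ξ : I → ℤ} (q : IndexSet ξ) : ℤ := q.1.2

/-- The natural number `(ξ(i) - p) / 2` of `(i, p)`. -/
def IndexSet.depth {ξ : I → ℤ} (q : IndexSet ξ) : ℕ := ((ξ q.vertex - q.pos) / 2).toNat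

theorem IndexSet.mk_depth {ξ : I → ℤ} (q : IndexSet ξ) :
    IndexSet.mk ξ q.vertex q.depth = q := by
  obtain ⟨⟨i, p⟩, k, hk⟩ := q
  simp only at hk
  subst hk
  simp [IndexSet.mk, IndexSet.depth, IndexSet.vertex, IndexSet.pos]
  rfl

theorem IndexSet.depth_mk (ξ : I → ℤ) (i : I) (k : ℕ) : (IndexSet.mk ξ i k).depth = k := by
  simp [IndexSet.mk, IndexSet.depth, IndexSet.vertex, IndexSet.pos]

variable [Fintype I] [DecidableEq I] (D : SimplyLacedCartan I)

open Classical in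
/-- `i*`, the vertex with `w_0(α_i) = - α_{i*}`, for `w_0` the product along the word `w`. -/
def starVertex (w : List I) (i : I) : I :=
  if h : ∃ j, wordProd D w (simpleRoot i) = -simpleRoot j then h.choose else i

/-- The infinite sequence `î_Q = (i_1, i_2, …)` that extends `w = (i_1, …, i_N)` by
`i_{k+Nm} = i_k` for even `m` and `i_{k+Nm} = i_k^*` for odd `m` (`1 ≤ k ≤ N`); the index `t`
starts at `1`. -/
def iHat [Nonempty I] (w : List I) (t : ℕ) : I :=
  let a := w.getD ((t - 1) % w.length) (Classical.arbitrary I)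
  if Even ((t - 1) / w.length) then a else starVertex D w a

/-- `φ⁻¹(t) = (i_t, ξ(i_t) - 2 N_Q(t) + 2)`, where `N_Q(t) = #{1 ≤ t' ≤ t | i_{t'} = i_t}`, for
`t ≥ 1`. It is written with `N_Q(t) - 1 = #{1 ≤ t' < t | i_{t'} = i_t}`. -/
def phiInv [Nonempty I] (ξ : I → ℤ) (w : List I) (t : ℕ) : IndexSet ξ :=
  IndexSet.mk ξ (iHat D w t)
    ((Finset.Ico 1 t).filter fun t' => iHat D w t' = iHat D w t).card

open Classical in
/-- `β_{φ(j, ξ(j) - 2k)}`: starting from `γ_j`, apply `τ` repeatedly and correct the sign so that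
the result is a positive root. -/
def betaSeq (Q : I → I → Prop) (τ : (I → ℤ) ≃ₗ[ℤ] (I → ℤ)) (j : I) : ℕ → (I → ℤ)
  | 0 => gammaRoot Q j
  | k + 1 =>
    if τ (betaSeq Q τ j k) ∈ posRoots D then τ (betaSeq Q τ j k) else -τ (betaSeq Q τ j k)

/-- `β_{φ(j,s)}` for `(j,s) ∈ I^{≤ξ}`. -/
def beta (Q : I → I → Prop) (τ : (I → ℤ) ≃ₗ[ℤ] (I → ℤ)) {ξ : I → ℤ} (q : IndexSet ξ) : I → ℤ :=
  betaSeq D Q τ q.vertex q.depth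

theorem betaSeq_ne_zero (Q : I → I → Prop) (τ : (I → ℤ) ≃ₗ[ℤ] (I → ℤ)) (j : I) (k : ℕ) :
    betaSeq D Q τ j k ≠ 0 := by
  induction k with
  | zero =>
    intro h
    have := congrFun h j
    simp [betaSeq, gammaRoot, Relation.ReflTransGen.refl] at this
  | succ k ih =>
    have : τ (betaSeq D Q τ j k) ≠ 0 := by simpa using ih
    rw [betaSeq]
    split_ifs
    · exact this
    · simpa using this

end Index

/-! ## The inverse of the quantum Cartan matrix -/

section QuantumCartan

variable {I : Type*} [Fintype I] [DecidableEq I] (D : SimplyLacedCartan I)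

/-- The quantum Cartan matrix `C(z)`, over the ring of Laurent series `ℤ((z))`. -/
def quantumCartan : Matrix I I (LaurentSeries ℤ) := Matrix.of fun i j =>
  if i = j then HahnSeries.single (1 : ℤ) (1 : ℤ) + HahnSeries.single (-1 : ℤ) (1 : ℤ)
  else if D.C i j = -1 then -1 else 0

/-- The quantum Cartan matrix is invertible over `ℤ((z))`. -/
theorem isUnit_det_quantumCartan : IsUnit (quantumCartan D).det := by
  let M : Matrix I I (PowerSeries ℤ) := Matrix.of fun i j =>
    if i = j then 1 + PowerSeries.X ^ 2 else if D.C i j = -1 then -PowerSeries.X else 0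
  have hM : IsUnit M.det := by
    rw [PowerSeries.isUnit_iff_constantCoeff, RingHom.map_det]
    have h : (PowerSeries.constantCoeff).mapMatrix M = (1 : Matrix I I ℤ) := by
      ext i j
      simp only [RingHom.mapMatrix_apply, Matrix.map_apply, M, Matrix.of_apply, Matrix.one_apply]
      split_ifs <;> simp
    rw [h]
    simp
  have h2 : quantumCartan D = (HahnSeries.single (-1 : ℤ) (1 : ℤ) : LaurentSeries ℤ) •
      (HahnSeries.ofPowerSeries ℤ ℤ).mapMatrix M := by
    ext1 i j
    simp only [quantumCartan, Matrix.smul_apply, RingHom.mapMatrix_apply, Matrix.map_apply, M,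
      Matrix.of_apply]
    split_ifs
    · simp [mul_add, HahnSeries.ofPowerSeries_X_pow, add_comm]
    · simp [HahnSeries.ofPowerSeries_X]
    · simp
  rw [h2, Matrix.det_smul, ← RingHom.map_det]
  refine IsUnit.mul (IsUnit.pow _ ?_) (hM.map _)
  exact IsUnit.of_mul_eq_one (HahnSeries.single (1 : ℤ) (1 : ℤ)) (by simp)

/-- `C̃_{ij}(m)`: the coefficient of `z^m` in the `(i,j)` entry of `C(z)⁻¹` for `m ≥ 1`, and `0`
for `m ≤ 0`. -/
def cTilde (i j : I) (m : ℤ) : ℤ :=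
  if 1 ≤ m then ((quantumCartan D)⁻¹ i j).coeff m else 0

end QuantumCartan

/-! ## The torus and the morphism `D̃_ξ` -/

section Morphism

/-- The Laurent polynomial ring `ℂ[v^{±1}, v ∈ V]`. -/
abbrev LaurentRing (V : Type*) : Type _ := AddMonoidAlgebra ℂ (V →₀ ℤ)

/-- The algebra morphism on a Laurent polynomial ring with given (invertible) values on the
variables. -/
def laurentLift {V A : Type*} [CommRing A] [Algebra ℂ A] (u : V → Aˣ) : LaurentRing V →ₐ[ℂ] A :=
  AddMonoidAlgebra.lift ℂ A (V →₀ ℤ)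
    { toFun := fun e => ((e.toAdd.prod fun v (k : ℤ) => u v ^ k : Aˣ) : A)
      map_one' := by simp
      map_mul' := fun a b => by
        rw [← Units.val_mul, toAdd_mul, Finsupp.prod_add_index']
        · simp
        · intro v m n
          exact zpow_add _ m n }

theorem laurentLift_single {V A : Type*} [CommRing A] [Algebra ℂ A] (u : V → Aˣ) (v : V) :
    laurentLift u (AddMonoidAlgebra.single (Finsupp.single v 1) 1) = (u v : A) := by
  rw [laurentLift, AddMonoidAlgebra.lift_single]
  change (1 : ℂ) • (((Finsupp.single v (1 : ℤ)).prod fun v (k : ℤ) => u v ^ k : Aˣ) : A) = _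
  rw [Finsupp.prod_single_index (by simp)]
  simp

/-- The complexified torus `ℂ ⊗ 𝒴^{≤ξ} = ℂ[Y_{i,p}^{±1}, (i,p) ∈ I^{≤ξ}]`. -/
abbrev Torus {I : Type*} (ξ : I → ℤ) : Type _ := LaurentRing (IndexSet ξ)

/-- The variable `Y_{i,p}`. -/
def Y {I : Type*} {ξ : I → ℤ} (q : IndexSet ξ) : Torus ξ :=
  AddMonoidAlgebra.single (Finsupp.single q 1) 1

/-- The field `ℂ(α_i, i ∈ I)`. -/
abbrev RootField (I : Type*) : Type _ := FractionRing (MvPolynomial I ℂ)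

variable {I : Type*} [Fintype I]

/-- An element `∑ x_i α_i` of the root lattice, as an element of `ℂ(α_i, i ∈ I)`. -/
def toField (x : I → ℤ) : RootField I :=
  algebraMap (MvPolynomial I ℂ) (RootField I) (∑ i, MvPolynomial.C (x i : ℂ) * MvPolynomial.X i)

theorem toField_ne_zero {x : I → ℤ} (hx : x ≠ 0) : toField x ≠ 0 := by
  classical
  obtain ⟨i, hi⟩ := Function.ne_iff.mp hx
  intro h
  have h1 : (∑ j, MvPolynomial.C (x j : ℂ) * MvPolynomial.X j : MvPolynomial I ℂ) = 0 :=
    (IsFractionRing.injective (MvPolynomial I ℂ) (RootField I)) (by simpa [toField] using h)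
  have h2 := congrArg (MvPolynomial.eval (Pi.single i (1 : ℂ))) h1
  simp [Pi.single_apply] at h2
  exact hi (by simpa using h2)

variable [DecidableEq I] (D : SimplyLacedCartan I)

/-- `β_{φ(j,s)}` as an invertible element of `ℂ(α_i, i ∈ I)`. -/
def betaUnit (Q : I → I → Prop) (τ : (I → ℤ) ≃ₗ[ℤ] (I → ℤ)) {ξ : I → ℤ} (q : IndexSet ξ) :
    (RootField I)ˣ :=
  Units.mk0 (toField (beta D Q τ q)) (toField_ne_zero (betaSeq_ne_zero D Q τ _ _))

/-- `D̃_ξ(Y_{i,p}) = ∏_{(j,s) ∈ I^{≤ξ}} β_{φ(j,s)} ^ (C̃_{ij}(s-p-1) - C̃_{ij}(s-p+1))`; the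
exponent vanishes for `s < p`, so only finitely many factors differ from `1`. -/
def dTildeY (Q : I → I → Prop) (τ : (I → ℤ) ≃ₗ[ℤ] (I → ℤ)) {ξ : I → ℤ} (q : IndexSet ξ) :
    (RootField I)ˣ :=
  ∏ᶠ r : IndexSet ξ, betaUnit D Q τ r ^
    (cTilde D q.vertex r.vertex (r.pos - q.pos - 1)
      - cTilde D q.vertex r.vertex (r.pos - q.pos + 1))

/-- The algebra morphism `D̃_ξ : ℂ ⊗ 𝒴^{≤ξ} → ℂ(α_i, i ∈ I)` with the above values on the
variables `Y_{i,p}`. -/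
def dTilde (Q : I → I → Prop) (τ : (I → ℤ) ≃ₗ[ℤ] (I → ℤ)) (ξ : I → ℤ) :
    Torus ξ →ₐ[ℂ] RootField I :=
  laurentLift (dTildeY D Q τ)

theorem dTilde_Y (Q : I → I → Prop) (τ : (I → ℤ) ≃ₗ[ℤ] (I → ℤ)) {ξ : I → ℤ} (q : IndexSet ξ) :
    dTilde D Q τ ξ (Y q) = (dTildeY D Q τ q : RootField I) :=
  laurentLift_single _ q

end Morphism

/-! ## The cluster algebra `𝒜^{≤ξ}` and the embedding `ι` -/

section Cluster

/-- A (labelled) seed in the field `F`, without frozen variables: a cluster and an exchange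
matrix, where `b u v` is the number of arrows `u → v` minus the number of arrows `v → u`. -/
structure Seed (V F : Type*) where
  x : V → F
  b : V → V → ℤ

open Classical in
/-- Mutation of a seed in direction `k`. -/
def Seed.mutate {V F : Type*} [Field F] (S : Seed V F) (k : V) : Seed V F where
  x := Function.update S.x k
    ((∏ᶠ v, S.x v ^ (S.b v k).toNat + ∏ᶠ v, S.x v ^ (S.b k v).toNat) / S.x k)
  b := fun u v => if u = k ∨ v = k then -S.b u v
    else S.b u v + max (S.b u k) 0 * max (S.b k v) 0 - max (-S.b u k) 0 * max (-S.b k v) 0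

/-- The cluster algebra of a seed: the algebra generated by the cluster variables of all seeds
obtained by finite sequences of mutations. -/
def clusterAlgebra {V F : Type*} [Field F] [Algebra ℂ F] (S : Seed V F) : Subalgebra ℂ F :=
  Algebra.adjoin ℂ {y | ∃ T : Seed V F,
    Relation.ReflTransGen (fun S₁ S₂ => ∃ k, S₂ = Seed.mutate S₁ k) S T ∧ ∃ v, y = T.x v}

variable {I : Type*} [Fintype I] (D : SimplyLacedCartan I) (ξ : I → ℤ)

/-- Arrows of the exchange quiver on `I^{≤ξ}`: `(i,r) → (j,s)` if and only if `c_{ij} ≠ 0` and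
`s = r + c_{ij}`. -/
def ExchangeArrow (q r : IndexSet ξ) : Prop :=
  D.C q.vertex r.vertex ≠ 0 ∧ r.pos = q.pos + D.C q.vertex r.vertex

/-- The field of rational functions in variables indexed by `I^{≤ξ}`. -/
abbrev ClusterField : Type _ := FractionRing (MvPolynomial (IndexSet ξ) ℂ)

open Classical in
/-- The initial seed of Hernandez and Leclerc; the variable with index `(i,p)` stands for the
class of the Kirillov-Reshetikhin module `X_{i,p}`. -/
def initialSeed : Seed (IndexSet ξ) (ClusterField ξ) where
  x := fun q => algebraMap (MvPolynomial (IndexSet ξ) ℂ) _ (MvPolynomial.X q)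
  b := fun q r => (if ExchangeArrow D ξ q r then 1 else 0) - (if ExchangeArrow D ξ r q then 1 else 0)

/-- The cluster algebra `𝒜^{≤ξ}`. -/
def clusterA : Subalgebra ℂ (ClusterField ξ) := clusterAlgebra (initialSeed D ξ)

/-- The initial cluster variables, as elements of `𝒜^{≤ξ}`. -/
def initialVar (q : IndexSet ξ) : clusterA D ξ :=
  ⟨(initialSeed D ξ).x q, Algebra.subset_adjoin ⟨_, Relation.ReflTransGen.refl, q, rfl⟩⟩

/-- The cluster variable `x_t` of the initial seed, `t ≥ 1`. -/
def clusterVar [DecidableEq I] [Nonempty I] (w : List I) (t : ℕ) : clusterA D ξ :=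
  initialVar D ξ (phiInv D ξ w t)

/-- The monomial `Y_{i,p} Y_{i,p+2} ⋯ Y_{i,ξ(i)}`, which is the truncated `q`-character of the
Kirillov-Reshetikhin module `X_{i,p}`. -/
def monomialKR {I : Type*} {ξ : I → ℤ} (q : IndexSet ξ) : Torus ξ :=
  ∏ l ∈ Finset.range (q.depth + 1), Y (IndexSet.mk ξ q.vertex l)

/-- The substitution `x_{(i,p)} ↦ Y_{i,p} Y_{i,p+2} ⋯ Y_{i,ξ(i)}` on polynomials. -/
def iotaPoly {I : Type*} (ξ : I → ℤ) : MvPolynomial (IndexSet ξ) ℂ →ₐ[ℂ] Torus ξ :=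
  MvPolynomial.aeval monomialKR

/-- The initial cluster variables as units of the field of rational functions. -/
def varUnit {I : Type*} (ξ : I → ℤ) (q : IndexSet ξ) : (ClusterField ξ)ˣ :=
  Units.mk0 (algebraMap (MvPolynomial (IndexSet ξ) ℂ) _ (MvPolynomial.X q)) (by
    rw [Ne, map_eq_zero_iff _ (IsFractionRing.injective _ _)]
    exact MvPolynomial.X_ne_zero q)

/-- `x_{(i,p)} / x_{(i,p+2)}`, where `x_{(i,p+2)}` is replaced by `1` if `p = ξ(i)`. -/
def quotUnit {I : Type*} (ξ : I → ℤ) (i : I) : ℕ → (ClusterField ξ)ˣ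
  | 0 => varUnit ξ (IndexSet.mk ξ i 0)
  | k + 1 => varUnit ξ (IndexSet.mk ξ i (k + 1)) / varUnit ξ (IndexSet.mk ξ i k)

theorem prod_quotUnit {I : Type*} (ξ : I → ℤ) (i : I) (k : ℕ) :
    ∏ l ∈ Finset.range (k + 1), quotUnit ξ i l = varUnit ξ (IndexSet.mk ξ i k) := by
  induction k with
  | zero => simp [quotUnit]
  | succ k ih => rw [Finset.prod_range_succ, ih, quotUnit, mul_div_cancel]

theorem iotaPoly_injective {I : Type*} (ξ : I → ℤ) : Function.Injective (iotaPoly ξ) := by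
  let κ : Torus ξ →ₐ[ℂ] ClusterField ξ := laurentLift fun q => quotUnit ξ q.vertex q.depth
  have h : κ.comp (iotaPoly ξ) = Algebra.algHom ℂ (MvPolynomial (IndexSet ξ) ℂ) _ := by
    apply MvPolynomial.algHom_ext
    intro q
    have h1 : ∀ l, κ (Y (IndexSet.mk ξ q.vertex l)) = (quotUnit ξ q.vertex l : ClusterField ξ) := by
      intro l
      have h2 := laurentLift_single (A := ClusterField ξ)
        (fun q : IndexSet ξ => quotUnit ξ q.vertex q.depth) (IndexSet.mk ξ q.vertex l)
      simp only [IndexSet.depth_mk] at h2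
      exact h2
    simp only [AlgHom.comp_apply, iotaPoly, MvPolynomial.aeval_X, monomialKR, map_prod, h1]
    rw [← Units.coe_prod, prod_quotUnit, IndexSet.mk_depth]
    rfl
  intro a b hab
  have h3 : κ.comp (iotaPoly ξ) a = κ.comp (iotaPoly ξ) b := by
    simp only [AlgHom.comp_apply, hab]
  rw [h] at h3
  exact IsFractionRing.injective (MvPolynomial (IndexSet ξ) ℂ) (ClusterField ξ) h3

/-- The algebra morphism `ι` on `𝒜^{≤ξ}` with `ι(x_{(i,p)}) = Y_{i,p} Y_{i,p+2} ⋯ Y_{i,ξ(i)}`. As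
elements of `𝒜^{≤ξ}` are rational functions in the initial variables, `ι` is written with values in
the fraction field of the torus `ℂ ⊗ 𝒴^{≤ξ}`. -/
def iota : clusterA D ξ →ₐ[ℂ] FractionRing (Torus ξ) :=
  (IsFractionRing.liftAlgHom (K := ClusterField ξ)
    (g := (Algebra.algHom ℂ (Torus ξ) (FractionRing (Torus ξ))).comp (iotaPoly ξ))
    ((IsFractionRing.injective (Torus ξ) (FractionRing (Torus ξ))).comp
      (iotaPoly_injective ξ))).comp (clusterA D ξ).val

theorem iota_initialVar (q : IndexSet ξ) :
    iota D ξ (initialVar D ξ q) = algebraMap (Torus ξ) (FractionRing (Torus ξ)) (monomialKR q) := by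
  simp [iota, initialVar, initialSeed, iotaPoly]
  rfl

end Cluster

end HL

end

/-!
The Euler form `⟨·,·⟩_Q` is unimodular, the roots `γ_j` form the basis dual to the simple roots, and
`⟨x, τ y⟩ = -⟨y, x⟩` for the Coxeter element `τ`. Put `ρ_{j,r} = τ^r γ_j`; up to sign these are the
roots `β_t`, placed at the vertices `(j, ξ(j) - 2r)` of the repetition quiver. The values
`⟨ρ_{i,a}, ρ_{j,r}⟩` satisfy the recursion `C(z) C̃(z) = 1` and hence are coefficients of `C̃_{ij}`.

The product defining `D̃_ξ (Y_{i,p} ⋯ Y_{i,ξ(i)})` telescopes, so that a positive root `β` occurs in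
it with exponent `-∑ ±⟨ρ_{i,a}, β⟩`, the sum being over the occurrences of `±β` among the `ρ_{j,r}`
above `(i,p)`. Pairing with the `ρ_{j,r}` on the lower boundary of such a region is a Weyl group
element, which is multiplied by a simple reflection each time a vertex is added to the region.
A simple reflection changes the sign of no positive root except the simple one, so the occurrences
of `β` and `-β` alternate: the sum of their signs is `0` or `1` according to whether the image of
`β` under that Weyl group element is positive or negative. The coordinate of this image at `i` is
`-⟨ρ_{i,a}, β⟩`, so in the second case `⟨ρ_{i,a}, β⟩ ≥ 0` and the exponent is `-|⟨β_t, β⟩|`.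
-/

noncomputable section

namespace HL

open scoped Matrix

section Roots

variable {I : Type*} [Fintype I] (D : SimplyLacedCartan I)

theorem form_comm (x y : I → ℤ) : x ⬝ᵥ D.C *ᵥ y = y ⬝ᵥ D.C *ᵥ x := by
  rw [Matrix.dotProduct_mulVec, ← Matrix.mulVec_transpose, D.symm.eq, dotProduct_comm]

theorem form_pos {x : I → ℤ} (hx : x ≠ 0) : 0 < x ⬝ᵥ D.C *ᵥ x := by
  have hx' : (fun i => (x i : ℝ)) ≠ 0 := fun h => hx (funext fun i => by simpa using congrFun h i)
  have hcast : star (fun i => (x i : ℝ)) ⬝ᵥ (D.C.map (Int.cast : ℤ → ℝ) *ᵥ fun i => (x i : ℝ))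
      = ((x ⬝ᵥ D.C *ᵥ x : ℤ) : ℝ) := by
    simp [dotProduct, Matrix.mulVec]
  exact_mod_cast hcast ▸ D.posDef.dotProduct_mulVec_pos hx'

theorem form_left_ext {x y : I → ℤ} (h : ∀ z, x ⬝ᵥ D.C *ᵥ z = y ⬝ᵥ D.C *ᵥ z) : x = y := by
  by_contra hne
  refine (form_pos D (sub_ne_zero.mpr hne)).ne' ?_
  rw [sub_dotProduct, h, sub_self]

theorem form_even (x : I → ℤ) : Even (x ⬝ᵥ D.C *ᵥ x) := by
  have hsum : x ⬝ᵥ D.C *ᵥ x = ∑ p : I × I, x p.1 * (D.C p.1 p.2 * x p.2) := by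
    simp [dotProduct, Matrix.mulVec, Finset.mul_sum, Fintype.sum_prod_type]
  rw [hsum, ← ZMod.intCast_eq_zero_iff_even, Int.cast_sum]
  refine Finset.sum_involution (fun p _ => p.swap) (fun p _ => ?_) (fun p _ hp => ?_)
    (fun _ _ => Finset.mem_univ _) (fun p _ => p.swap_swap)
  · rw [← Int.cast_add, ZMod.intCast_eq_zero_iff_even, Prod.fst_swap, Prod.snd_swap,
      D.symm.apply p.1 p.2]
    exact ⟨x p.1 * (D.C p.1 p.2 * x p.2), by ring⟩
  · contrapose! hp
    have hdiag : p.2 = p.1 := congrArg Prod.fst hp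
    rw [ZMod.intCast_eq_zero_iff_even, hdiag, D.diag]
    exact ⟨x p.1 * x p.1, by ring⟩

theorem nonneg_or_nonpos_of_form_eq_two {x : I → ℤ} (hx : x ⬝ᵥ D.C *ᵥ x = 2) :
    0 ≤ x ∨ x ≤ 0 := by
  by_contra! hmixed
  have hcross : x⁺ ⬝ᵥ D.C *ᵥ x⁻ ≤ 0 := by
    simp only [dotProduct, Matrix.mulVec, Finset.mul_sum]
    refine Finset.sum_nonpos fun i _ => Finset.sum_nonpos fun j _ => ?_
    have hi : 0 ≤ x⁺ i := posPart_nonneg x i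
    have hj : 0 ≤ x⁻ j := negPart_nonneg x j
    by_cases hij : i = j
    · subst hij
      have hdisj : x⁺ i = 0 ∨ x⁻ i = 0 := by
        simpa [Pi.posPart_apply, Pi.negPart_apply] using le_total (x i) 0
      rcases hdisj with h | h <;> simp [h]
    · rcases D.simplyLaced hij with h | h <;> rw [h] <;> nlinarith
  have hpos := form_pos D (mt posPart_eq_zero.mp hmixed.2)
  have hneg := form_pos D (mt negPart_eq_zero.mp hmixed.1)
  obtain ⟨a, ha⟩ := form_even D x⁺
  obtain ⟨b, hb⟩ := form_even D x⁻
  rw [← posPart_sub_negPart x] at hx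
  simp only [Matrix.mulVec_sub, sub_dotProduct, dotProduct_sub, form_comm D x⁻ x⁺] at hx
  omega

variable [DecidableEq I]

theorem form_weyl_apply_apply {w : (I → ℤ) ≃ₗ[ℤ] (I → ℤ)} (hw : w ∈ weylGroup D) (x y : I → ℤ) :
    w x ⬝ᵥ D.C *ᵥ w y = x ⬝ᵥ D.C *ᵥ y := by
  have hadd := form_weyl D hw (x + y)
  simp only [map_add, Matrix.mulVec_add, add_dotProduct, dotProduct_add, form_weyl D hw,
    form_comm D (w y) (w x), form_comm D y x] at hadd
  omega

theorem simpleReflection_apply (i : I) (x : I → ℤ) :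
    simpleReflection D i x = x - (D.C *ᵥ x) i • (simpleRoot i : I → ℤ) := by
  simp [simpleReflection, Module.reflection_apply, coroot]

theorem simpleReflection_apply_self (i : I) (x : I → ℤ) :
    simpleReflection D i x i = x i - (D.C *ᵥ x) i := by
  simp [simpleReflection_apply, simpleRoot]

theorem simpleReflection_apply_of_ne {i k : I} (h : k ≠ i) (x : I → ℤ) :
    simpleReflection D i x k = x k := by
  simp [simpleReflection_apply, simpleRoot, h]

theorem simpleReflection_mem_weylGroup (i : I) : simpleReflection D i ∈ weylGroup D :=
  Subgroup.subset_closure ⟨i, rfl⟩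

theorem eq_simpleRoot_of_form_eq_two {x : I → ℤ} (hx : x ⬝ᵥ D.C *ᵥ x = 2) (h0 : 0 ≤ x)
    {i : I} (hi : ∀ k, k ≠ i → x k = 0) : x = simpleRoot i := by
  have hsmul : x = x i • (simpleRoot i : I → ℤ) := by
    ext k
    rcases eq_or_ne k i with rfl | hk
    · simp [simpleRoot]
    · simp [simpleRoot, hk, hi k hk]
  have hsq : x i * x i * 2 = 2 := by
    rw [hsmul] at hx
    simp only [Matrix.mulVec_smul, smul_dotProduct, dotProduct_smul, smul_eq_mul] at hx
    simpa [simpleRoot, D.diag, mul_assoc] using hx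
  have hone : x i = 1 := by nlinarith [show 0 ≤ x i from h0 i]
  rw [hsmul, hone, one_smul]

theorem simpleReflection_nonneg {x : I → ℤ} (hx : x ⬝ᵥ D.C *ᵥ x = 2) (h0 : 0 ≤ x) {i : I}
    (hi : x ≠ simpleRoot i) : 0 ≤ simpleReflection D i x := by
  refine (nonneg_or_nonpos_of_form_eq_two D ((form_reflection D i x).trans hx)).resolve_right
    fun hle => hi (eq_simpleRoot_of_form_eq_two D hx h0 fun k hk => le_antisymm ?_ (h0 k))
  exact (simpleReflection_apply_of_ne D hk x).ge.trans (hle k)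

theorem neg_mem_roots {x : I → ℤ} (hx : x ∈ roots D) : -x ∈ roots D := by
  obtain ⟨w, hw, i, rfl⟩ := hx
  refine ⟨w * simpleReflection D i, mul_mem hw (simpleReflection_mem_weylGroup D i), i, ?_⟩
  rw [LinearEquiv.mul_apply, simpleReflection, Module.reflection_apply_self, map_neg]

theorem mem_posRoots_or_neg_mem_posRoots {x : I → ℤ} (hx : x ∈ roots D) :
    x ∈ posRoots D ∨ -x ∈ posRoots D := by
  refine (nonneg_or_nonpos_of_form_eq_two D (form_root D hx)).imp (fun h => ⟨hx, h⟩) fun h => ?_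
  exact ⟨neg_mem_roots D hx, fun i => neg_nonneg.mpr (h i)⟩

end Roots

section Euler

variable {I : Type*}

open Classical in
/-- The `0`-`1` matrix `A` with `A i j = #{i → j}`. -/
def arrowMatrix (Q : I → I → Prop) : Matrix I I ℤ := Matrix.of fun i j => if Q i j then 1 else 0

theorem arrowMatrix_nonneg (Q : I → I → Prop) (i j : I) : 0 ≤ arrowMatrix Q i j := by
  rw [arrowMatrix, Matrix.of_apply]
  split_ifs <;> decide

theorem arrowMatrix_smul_congr {M : Type*} [AddCommGroup M] {Q : I → I → Prop} {i j : I} {x y : M}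
    (h : Q i j → x = y) : arrowMatrix Q i j • x = arrowMatrix Q i j • y := by
  by_cases hij : Q i j
  · rw [h hij]
  · simp [arrowMatrix, hij]

variable [Fintype I] [DecidableEq I]

/-- The adjacency matrix of the Dynkin diagram. -/
def SimplyLacedCartan.adj (D : SimplyLacedCartan I) : Matrix I I ℤ := (2 : ℤ) • 1 - D.C

theorem adj_apply (D : SimplyLacedCartan I) (i j : I) :
    D.adj i j = (if i = j then 2 else 0) - D.C i j := by
  rw [SimplyLacedCartan.adj, Matrix.sub_apply, Matrix.smul_apply, Matrix.one_apply, smul_ite,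
    smul_zero, smul_eq_mul, mul_one]

theorem simpleReflection_apply_self_eq_adj (D : SimplyLacedCartan I) (i : I) (x : I → ℤ) :
    simpleReflection D i x i = (D.adj *ᵥ x) i - x i := by
  simp only [simpleReflection_apply_self, SimplyLacedCartan.adj, Matrix.sub_mulVec,
    Matrix.smul_mulVec, Matrix.one_mulVec, Pi.sub_apply, Pi.smul_apply, smul_eq_mul]
  ring

theorem adj_eq_add_transpose {D : SimplyLacedCartan I} {Q : I → I → Prop}
    (hQ : IsOrientation D Q) : D.adj = arrowMatrix Q + (arrowMatrix Q)ᵀ := by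
  ext i j
  simp only [adj_apply, Matrix.add_apply, Matrix.transpose_apply, arrowMatrix, Matrix.of_apply]
  by_cases hij : i = j
  · subst hij
    have hloop : ¬ Q i i := fun h => by simpa [D.diag] using hQ.1 i i h
    simp [hloop, D.diag]
  rcases D.simplyLaced hij with h | h
  · have hij' : ¬ Q i j := fun h' => by simpa [h] using hQ.1 i j h'
    have hji' : ¬ Q j i := fun h' => by simpa [h, D.symm.apply i j] using hQ.1 j i h'
    simp [h, hij, hij', hji']
  · rcases hQ.2 i j h with ⟨h1, h2⟩ | ⟨h1, h2⟩ <;> simp [h, h1, h2, hij]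

/-- The Euler-Ringel form as a bilinear map, with Gram matrix `1 - A` in the simple roots. -/
def eulerBilin (Q : I → I → Prop) : (I → ℤ) →ₗ[ℤ] (I → ℤ) →ₗ[ℤ] ℤ :=
  Matrix.toLinearMap₂' ℤ (1 - arrowMatrix Q)

theorem eulerBilin_apply (Q : I → I → Prop) (x y : I → ℤ) :
    eulerBilin Q x y = x ⬝ᵥ (1 - arrowMatrix Q) *ᵥ y :=
  Matrix.toLinearMap₂'_apply' _ x y

theorem eulerBilin_eq_eulerForm (Q : I → I → Prop) (x y : I → ℤ) :
    eulerBilin Q x y = eulerForm Q x y := by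
  simp only [eulerBilin_apply, eulerForm, dotProduct, Matrix.mulVec, Finset.mul_sum,
    Matrix.sub_apply, Matrix.one_apply, arrowMatrix, Matrix.of_apply]
  exact Finset.sum_congr rfl fun i _ => Finset.sum_congr rfl fun j _ => by
    split_ifs <;> ring

theorem eulerBilin_simpleRoot_left (Q : I → I → Prop) (i : I) (y : I → ℤ) :
    eulerBilin Q (simpleRoot i) y = y i - (arrowMatrix Q *ᵥ y) i := by
  simp [eulerBilin_apply, simpleRoot, Matrix.sub_mulVec]

theorem eulerBilin_simpleRoot_right (Q : I → I → Prop) (x : I → ℤ) (j : I) :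
    eulerBilin Q x (simpleRoot j) = x j - (x ᵥ* arrowMatrix Q) j := by
  simp [eulerBilin_apply, Matrix.dotProduct_mulVec, Matrix.vecMul_sub, simpleRoot,
    -Matrix.mulVec_single]

variable {D : SimplyLacedCartan I} {Q : I → I → Prop}

theorem form_eq_eulerBilin_add (hQ : IsOrientation D Q) (x y : I → ℤ) :
    x ⬝ᵥ D.C *ᵥ y = eulerBilin Q x y + eulerBilin Q y x := by
  have hC : D.C = (1 - arrowMatrix Q) + (1 - arrowMatrix Q)ᵀ := by
    rw [Matrix.transpose_sub, Matrix.transpose_one, sub_add_sub_comm,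
      ← adj_eq_add_transpose hQ, SimplyLacedCartan.adj, ← two_smul ℤ (1 : Matrix I I ℤ)]
    exact (sub_sub_cancel _ _).symm
  rw [hC, Matrix.add_mulVec, dotProduct_add, Matrix.mulVec_transpose, dotProduct_comm x (y ᵥ* _),
    ← Matrix.dotProduct_mulVec, eulerBilin_apply, eulerBilin_apply]

theorem eulerBilin_self_pos (hQ : IsOrientation D Q) {x : I → ℤ} (hx : x ≠ 0) :
    0 < eulerBilin Q x x := by
  have h := form_eq_eulerBilin_add hQ x x ▸ form_pos D hx
  omega

theorem eulerBilin_right_ext (hQ : IsOrientation D Q) {x y : I → ℤ}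
    (h : ∀ z, eulerBilin Q z x = eulerBilin Q z y) : x = y := by
  by_contra hne
  refine (eulerBilin_self_pos hQ (sub_ne_zero.mpr hne)).ne' ?_
  rw [map_sub, h, sub_self]

end Euler

section DualBasis

variable {I : Type*} {Q : I → I → Prop}

theorem IsHeightFunction.le_of_path {ξ : I → ℤ} (hξ : IsHeightFunction Q ξ) {i j : I}
    (h : Relation.ReflTransGen Q i j) : ξ j ≤ ξ i := by
  induction h with
  | refl => exact le_rfl
  | tail _ h ih => have := hξ _ _ h; omega

theorem gammaRoot_of_path {i j : I} (h : Relation.ReflTransGen Q i j) : gammaRoot Q j i = 1 :=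
  if_pos h

theorem gammaRoot_of_not_path {i j : I} (h : ¬ Relation.ReflTransGen Q i j) :
    gammaRoot Q j i = 0 :=
  if_neg h

theorem gammaRoot_nonneg (j : I) : 0 ≤ gammaRoot Q j := fun i => by
  by_cases h : Relation.ReflTransGen Q i j
  · exact (gammaRoot_of_path h).ge.trans' zero_le_one
  · exact (gammaRoot_of_not_path h).ge

variable [Fintype I]

theorem sum_arrowMatrix_gammaRoot_eq_zero {i j : I}
    (h : ∀ k, Q k j → ¬ Relation.ReflTransGen Q i k) :
    ∑ k, arrowMatrix Q k j • gammaRoot Q k i = 0 :=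
  Finset.sum_eq_zero fun k _ =>
    (arrowMatrix_smul_congr fun hk => gammaRoot_of_not_path (h k hk)).trans (smul_zero _)

theorem one_le_sum_arrowMatrix_gammaRoot {i j k : I} (hkj : Q k j)
    (hik : Relation.ReflTransGen Q i k) : 1 ≤ ∑ k, arrowMatrix Q k j • gammaRoot Q k i := by
  have hterm : arrowMatrix Q k j • gammaRoot Q k i = 1 := by
    simp [arrowMatrix, hkj, gammaRoot_of_path hik]
  rw [← hterm]
  exact Finset.single_le_sum (f := fun k => arrowMatrix Q k j • gammaRoot Q k i)
    (fun k _ => smul_nonneg (arrowMatrix_nonneg Q k j) (gammaRoot_nonneg k i)) (Finset.mem_univ k)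

variable [DecidableEq I]

theorem eulerBilin_simpleRoot_add_sum {g : I → I → ℤ} {j : I}
    (hg : ∀ k, Q k j → ∀ x, eulerBilin Q x (g k) = x k) (x : I → ℤ) :
    eulerBilin Q x (simpleRoot j + ∑ k, arrowMatrix Q k j • g k) = x j := by
  have hterm : ∀ k, arrowMatrix Q k j • eulerBilin Q x (g k) = x k * arrowMatrix Q k j := fun k =>
    (arrowMatrix_smul_congr fun hk => hg k hk x).trans (mul_comm _ _)
  simp only [map_add, map_sum, map_smul, hterm, eulerBilin_simpleRoot_right]
  exact sub_add_cancel _ _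

variable {D : SimplyLacedCartan I} {ξ : I → ℤ}

theorem gammaRoot_eq_add_of_dual (hQ : IsOrientation D Q) (hξ : IsHeightFunction Q ξ) {j : I}
    (hdual : ∀ k, ξ j < ξ k → ∀ x, eulerBilin Q x (gammaRoot Q k) = x k) :
    gammaRoot Q j = simpleRoot j + ∑ k, arrowMatrix Q k j • gammaRoot Q k := by
  set p := simpleRoot j + ∑ k, arrowMatrix Q k j • gammaRoot Q k with hp
  have hlt : ∀ k, Q k j → ξ j < ξ k := fun k hk => by have := hξ k j hk; omega
  have hpj : p j = 1 := by
    simp only [hp, Pi.add_apply, Finset.sum_apply, Pi.smul_apply]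
    rw [sum_arrowMatrix_gammaRoot_eq_zero fun k hk hjk =>
      (hlt k hk).not_ge (hξ.le_of_path hjk), simpleRoot, Pi.single_eq_same, add_zero]
  have hpi : ∀ i, i ≠ j → p i = ∑ k, arrowMatrix Q k j • gammaRoot Q k i := fun i hi => by
    simp [hp, simpleRoot, hi]
  ext i
  by_cases hij : Relation.ReflTransGen Q i j
  · rw [gammaRoot_of_path hij]
    rcases eq_or_ne i j with rfl | hi
    · exact hpj.symm
    obtain ⟨k, hik, hkj⟩ := (Relation.ReflTransGen.cases_tail hij).resolve_left hi.symm
    have hpi_pos : 1 ≤ p i := hpi i hi ▸ one_le_sum_arrowMatrix_gammaRoot hkj hik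
    have hξij : ξ j < ξ i := (hlt k hkj).trans_le (hξ.le_of_path hik)
    have hγj : gammaRoot Q i j = 0 :=
      gammaRoot_of_not_path fun h => hξij.not_ge (hξ.le_of_path h)
    -- Positivity of `⟨p - γ_i, p - γ_i⟩ = 2 - p i` bounds the coordinate from above.
    have hne : p - gammaRoot Q i ≠ 0 := fun h => by simpa [hpj, hγj] using congrFun h j
    have hpos := eulerBilin_self_pos hQ hne
    simp only [map_sub, LinearMap.sub_apply, hdual i hξij, hp,
      eulerBilin_simpleRoot_add_sum fun k hk => hdual k (hlt k hk)] at hpos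
    rw [← hp, hpj, hγj, gammaRoot_of_path .refl] at hpos
    omega
  · have hi : i ≠ j := fun h => hij (h ▸ .refl)
    rw [gammaRoot_of_not_path hij, hpi i hi,
      sum_arrowMatrix_gammaRoot_eq_zero fun k hk hik => hij (hik.tail hk)]

theorem eulerBilin_gammaRoot (hQ : IsOrientation D Q) (hξ : IsHeightFunction Q ξ) (x : I → ℤ)
    (j : I) : eulerBilin Q x (gammaRoot Q j) = x j := by
  induction j using (Finite.wellFounded_of_trans_of_irrefl (ξ ⁻¹'o (· > ·))).induction
    generalizing x with
  | _ j ih =>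
    rw [gammaRoot_eq_add_of_dual hQ hξ fun k hk x => ih k hk x]
    exact eulerBilin_simpleRoot_add_sum (fun k hk x => ih k (by
      change ξ j < ξ k
      have := hξ k j hk
      omega) x) x

theorem gammaRoot_eq_add (hQ : IsOrientation D Q) (hξ : IsHeightFunction Q ξ) (j : I) :
    gammaRoot Q j = simpleRoot j + ∑ k, arrowMatrix Q k j • gammaRoot Q k :=
  gammaRoot_eq_add_of_dual hQ hξ fun k _ x => eulerBilin_gammaRoot hQ hξ x k

end DualBasis

section Coxeter

variable {I : Type*} {Q : I → I → Prop}

theorem IsAdapted.pairwise_not_arrow {l : List I} (hnodup : l.Nodup) (hl : IsAdapted Q l) :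
    l.Pairwise fun a b => ¬ Q b a := by
  induction l generalizing Q with
  | nil => exact List.Pairwise.nil
  | cons i l ih =>
    obtain ⟨hi, hnodup⟩ := List.nodup_cons.mp hnodup
    refine List.pairwise_cons.mpr ⟨fun b _ => hl.1 b, ?_⟩
    refine (ih hnodup hl.2).imp_of_mem fun {a b} ha hb hab hba => hab (Or.inr ⟨?_, hba⟩)
    rintro (rfl | rfl)
    exacts [hi hb, hi ha]

variable [Fintype I]

theorem arrowMatrix_mulVec_congr {i : I} {x y : I → ℤ} (h : ∀ j, Q i j → x j = y j) :
    (arrowMatrix Q *ᵥ x) i = (arrowMatrix Q *ᵥ y) i :=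
  Finset.sum_congr rfl fun j _ => arrowMatrix_smul_congr (h j)

theorem arrowMatrix_vecMul_congr {j : I} {x y : I → ℤ} (h : ∀ i, Q i j → x i = y i) :
    (x ᵥ* arrowMatrix Q) j = (y ᵥ* arrowMatrix Q) j := by
  rw [← Matrix.mulVec_transpose, ← Matrix.mulVec_transpose]
  exact Finset.sum_congr rfl fun i _ => arrowMatrix_smul_congr (h i)

variable [DecidableEq I] {D : SimplyLacedCartan I}

theorem wordProd_cons (D : SimplyLacedCartan I) (i : I) (l : List I) (x : I → ℤ) :
    wordProd D (i :: l) x = simpleReflection D i (wordProd D l x) :=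
  rfl

theorem wordProd_apply_of_notMem {l : List I} {k : I} (hk : k ∉ l) (x : I → ℤ) :
    wordProd D l x k = x k := by
  induction l with
  | nil => rfl
  | cons i l ih =>
    rw [List.mem_cons, not_or] at hk
    rw [wordProd_cons, simpleReflection_apply_of_ne D hk.1, ih hk.2]

theorem wordProd_apply_add (hQ : IsOrientation D Q) {l : List I} (hnodup : l.Nodup)
    (hl : l.Pairwise fun a b => ¬ Q b a) (x : I → ℤ) {k : I} (hk : k ∈ l) :
    wordProd D l x k + x k = (arrowMatrix Q *ᵥ wordProd D l x) k + (x ᵥ* arrowMatrix Q) k := by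
  induction l with
  | nil => simp at hk
  | cons i l ih =>
    obtain ⟨hi, hnodup⟩ := List.nodup_cons.mp hnodup
    obtain ⟨hli, hl⟩ := List.pairwise_cons.mp hl
    have hloop : ¬ Q i i := fun h => by simpa [D.diag] using hQ.1 i i h
    have hmulVec : ∀ a, ¬ Q a i →
        (arrowMatrix Q *ᵥ wordProd D (i :: l) x) a = (arrowMatrix Q *ᵥ wordProd D l x) a :=
      fun a ha => arrowMatrix_mulVec_congr fun m hm =>
        simpleReflection_apply_of_ne D (fun h : m = i => ha (h ▸ hm)) _
    rcases List.mem_cons.mp hk with rfl | hkl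
    · have hvecMul : (wordProd D l x ᵥ* arrowMatrix Q) k = (x ᵥ* arrowMatrix Q) k :=
        arrowMatrix_vecMul_congr fun m hm =>
          wordProd_apply_of_notMem (fun hml => hli m hml hm) x
      rw [hmulVec k hloop, wordProd_cons, simpleReflection_apply_self_eq_adj,
        adj_eq_add_transpose hQ, Matrix.add_mulVec, Pi.add_apply, Matrix.mulVec_transpose, hvecMul,
        wordProd_apply_of_notMem hi, sub_add_cancel]
    · have hki : k ≠ i := fun h => hi (h ▸ hkl)
      rw [hmulVec k (hli k hkl), wordProd_cons, simpleReflection_apply_of_ne D hki,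
        ih hnodup hl hkl]

/-- `τ` is the Coxeter transformation of the Euler-Ringel form of `Q`, characterised by
`⟨y, τ x⟩ = -⟨x, y⟩`; the Coxeter element of an adapted word is one. -/
def IsCoxeterTransformation (Q : I → I → Prop) (τ : (I → ℤ) ≃ₗ[ℤ] (I → ℤ)) : Prop :=
  ∀ x y, eulerBilin Q y (τ x) = -eulerBilin Q x y

theorem IsCoxeterWord.isCoxeterTransformation (hQ : IsOrientation D Q) {c : List I}
    (hc : IsCoxeterWord Q c) : IsCoxeterTransformation Q (wordProd D c) := fun x y => by
  have hbasis : (eulerBilin Q).flip (wordProd D c x) = -eulerBilin Q x := by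
    refine (Pi.basisFun ℤ I).ext fun k => ?_
    have hk := wordProd_apply_add hQ hc.1 (hc.2.2.pairwise_not_arrow hc.1) x (hc.2.1 k)
    rw [Pi.basisFun_apply, LinearMap.flip_apply, LinearMap.neg_apply]
    change eulerBilin Q (simpleRoot k) _ = -eulerBilin Q x (simpleRoot k)
    rw [eulerBilin_simpleRoot_left, eulerBilin_simpleRoot_right]
    omega
  exact LinearMap.congr_fun hbasis y

end Coxeter

section QuantumCartan

variable {I : Type*} [Fintype I] [DecidableEq I] (D : SimplyLacedCartan I)

theorem adj_comm (i j : I) : D.adj i j = D.adj j i := by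
  simp [adj_apply, D.symm.apply j i, eq_comm]

theorem quantumCartan_eq : quantumCartan D =
    (HahnSeries.single (1 : ℤ) (1 : ℤ) + HahnSeries.single (-1 : ℤ) (1 : ℤ) : LaurentSeries ℤ) • 1
      - D.adj.map HahnSeries.C := by
  ext1 i j
  rcases eq_or_ne i j with rfl | hij
  · simp [quantumCartan, adj_apply, D.diag]
  · rcases D.simplyLaced hij with h | h <;>
      simp [quantumCartan, adj_apply, hij, h]

theorem quantumCartan_inv_recursion (i j : I) (m : ℤ) :
    ((quantumCartan D)⁻¹ i j).coeff (m - 1) + ((quantumCartan D)⁻¹ i j).coeff (m + 1)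
      = ∑ k, D.adj j k * ((quantumCartan D)⁻¹ i k).coeff m + if i = j ∧ m = 0 then 1 else 0 := by
  have hinv := Matrix.nonsing_inv_mul _ (isUnit_det_quantumCartan D)
  nth_rewrite 2 [quantumCartan_eq] at hinv
  rw [mul_sub, Matrix.mul_smul, mul_one, sub_eq_iff_eq_add'] at hinv
  have hshift (f : LaurentSeries ℤ) :
      ((HahnSeries.single (1 : ℤ) (1 : ℤ) + HahnSeries.single (-1 : ℤ) (1 : ℤ)) * f).coeff m
        = f.coeff (m - 1) + f.coeff (m + 1) := by
    simp [add_mul, HahnSeries.coeff_single_mul]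
  have hterm (k : I) : ((quantumCartan D)⁻¹ i k * HahnSeries.C (D.adj k j)).coeff m
      = D.adj j k * ((quantumCartan D)⁻¹ i k).coeff m := by
    rw [mul_comm, HahnSeries.C_mul_eq_smul, HahnSeries.coeff_smul, adj_comm, smul_eq_mul]
  have hone : ((1 : Matrix I I (LaurentSeries ℤ)) i j).coeff m
      = if i = j ∧ m = 0 then 1 else 0 := by
    by_cases hij : i = j <;> simp [Matrix.one_apply, hij, HahnSeries.coeff_one]
  have hcoeff := congrArg (fun M : Matrix I I (LaurentSeries ℤ) => (M i j).coeff m) hinv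
  simpa only [Matrix.smul_apply, smul_eq_mul, hshift, Matrix.add_apply, Matrix.mul_apply,
    Matrix.map_apply, HahnSeries.coeff_add, HahnSeries.coeff_sum, hterm, hone] using hcoeff

theorem quantumCartan_inv_coeff_eq_zero {i : I} {f : I → ℤ} (hi : f i ≤ 1)
    (hf : ∀ j k, D.adj j k ≠ 0 → f j ≤ f k + 1) {j : I} {m : ℤ} (hm : m < f j) :
    ((quantumCartan D)⁻¹ i j).coeff m = 0 := by
  obtain ⟨b, hb⟩ := (Set.finite_range fun j => ((quantumCartan D)⁻¹ i j).order).bddBelow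
  obtain ⟨n, hn⟩ := Int.eq_ofNat_of_zero_le (a := max 0 (m + 1 - b)) (le_max_left _ _)
  replace hn : m < b + n := by omega
  induction n generalizing j m with
  | zero =>
    have hmb : m < b := by simpa using hn
    exact HahnSeries.coeff_eq_zero_of_lt_order (hmb.trans_le (hb ⟨j, rfl⟩))
  | succ n ih =>
    have hrec := quantumCartan_inv_recursion D i j (m - 1)
    have hneighbours : ∑ k, D.adj j k * ((quantumCartan D)⁻¹ i k).coeff (m - 1) = 0 := by
      refine Finset.sum_eq_zero fun k _ => ?_
      by_cases hjk : D.adj j k = 0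
      · rw [hjk, zero_mul]
      · have := hf j k hjk
        rw [ih (by omega) (by omega), mul_zero]
    have hsource : ¬ (i = j ∧ m - 1 = 0) := by
      rintro ⟨rfl, h⟩
      omega
    rwa [hneighbours, if_neg hsource, ih (by omega) (by omega), zero_add, sub_add_cancel,
      zero_add] at hrec

theorem cTilde_eq_coeff (i j : I) (m : ℤ) :
    cTilde D i j m = ((quantumCartan D)⁻¹ i j).coeff m := by
  unfold cTilde
  split_ifs with hm
  · rfl
  · exact (quantumCartan_inv_coeff_eq_zero D (f := 1) le_rfl (fun _ _ _ => by simp)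
      (not_le.mp hm)).symm

theorem cTilde_of_nonpos (i j : I) {m : ℤ} (hm : m ≤ 0) : cTilde D i j m = 0 :=
  if_neg (by omega)

theorem cTilde_recursion (i j : I) (m : ℤ) :
    cTilde D i j (m - 1) + cTilde D i j (m + 1)
      = ∑ k, D.adj j k * cTilde D i k m + if i = j ∧ m = 0 then 1 else 0 := by
  simpa only [cTilde_eq_coeff] using quantumCartan_inv_recursion D i j m

theorem cTilde_one (i j : I) : cTilde D i j 1 = if i = j then 1 else 0 := by
  simpa [cTilde_of_nonpos] using cTilde_recursion D i j 0

variable {D}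

theorem adjacent_of_adj_ne_zero {Q : I → I → Prop} (hQ : IsOrientation D Q) {i j : I}
    (h : D.adj i j ≠ 0) : Q i j ∨ Q j i := by
  contrapose! h
  simp [adj_eq_add_transpose hQ, arrowMatrix, h]

theorem cTilde_eq_zero_of_lt_height_sub {Q : I → I → Prop} (hQ : IsOrientation D Q) {ξ : I → ℤ}
    (hξ : IsHeightFunction Q ξ) {i j : I} {m : ℤ} (hm : m < ξ j - ξ i) : cTilde D i j m = 0 := by
  rw [cTilde_eq_coeff]
  refine quantumCartan_inv_coeff_eq_zero D (f := fun k => ξ k - ξ i) (by omega)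
    (fun k l hkl => ?_) hm
  rcases adjacent_of_adj_ne_zero hQ hkl with h | h <;>
  · have := hξ _ _ h
    omega

end QuantumCartan

section Slices

variable {I : Type*}

/-- `τ^r γ_j`, which is `β_{φ(j, ξ(j) - 2r)}` up to sign. -/
def orbitRoot (Q : I → I → Prop) (τ : (I → ℤ) ≃ₗ[ℤ] (I → ℤ)) (j : I) (r : ℕ) : I → ℤ :=
  τ^[r] (gammaRoot Q j)

theorem orbitRoot_succ (Q : I → I → Prop) (τ : (I → ℤ) ≃ₗ[ℤ] (I → ℤ)) (j : I) (r : ℕ) :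
    orbitRoot Q τ j (r + 1) = τ (orbitRoot Q τ j r) :=
  Function.iterate_succ_apply' _ _ _

/-- A slice of the repetition quiver, encoded by the depths `d j` of its vertices
`(j, ξ(j) - 2 d(j))`: the heights of neighbours differ by one. -/
def IsSlice (Q : I → I → Prop) (d : I → ℕ) : Prop :=
  ∀ i j, Q i j → d j = d i ∨ d i = d j + 1

/-- `j` is a source of the slice `d`: its height exceeds that of every neighbour by one. Then `d`
can be flipped at `j`, i.e. replaced by `d + Pi.single j 1`. -/
def IsSliceSource (Q : I → I → Prop) (d : I → ℕ) (j : I) : Prop :=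
  (∀ k, Q j k → d k = d j) ∧ ∀ k, Q k j → d k = d j + 1

/-- The slice formed, for each `j`, by the vertex `(j, s)` of `I^{≤ξ}` with `s` maximal subject to
`s ≤ p`. -/
def heightSlice (ξ : I → ℤ) (p : ℤ) (j : I) : ℕ := ((ξ j - p + 1) / 2).toNat

theorem lt_heightSlice_iff {ξ : I → ℤ} {p : ℤ} {j : I} {r : ℕ} :
    r < heightSlice ξ p j ↔ p < ξ j - 2 * (r : ℤ) := by
  unfold heightSlice
  omega

theorem heightSlice_self (ξ : I → ℤ) (i : I) (a : ℕ) : heightSlice ξ (ξ i - 2 * a) i = a := by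
  unfold heightSlice
  omega

variable {Q : I → I → Prop} {ξ : I → ℤ}

theorem isSlice_heightSlice (hξ : IsHeightFunction Q ξ) (p : ℤ) : IsSlice Q (heightSlice ξ p) :=
  fun i j hij => by
    have := hξ i j hij
    unfold heightSlice
    omega

theorem isSliceSource_heightSlice (hξ : IsHeightFunction Q ξ) (i : I) (a : ℕ) :
    IsSliceSource Q (heightSlice ξ (ξ i - 2 * a)) i := by
  constructor <;>
  · intro k hk
    have := hξ _ _ hk
    unfold heightSlice
    omega

theorem IsSlice.exists_sink [Finite I] (hξ : IsHeightFunction Q ξ) {d : I → ℕ}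
    (hd : IsSlice Q d) (hd0 : d ≠ 0) :
    ∃ j, 0 < d j ∧ (∀ k, Q j k → d j = d k + 1) ∧ ∀ k, Q k j → d j = d k := by
  have hne : {i | 0 < d i}.Nonempty := by
    obtain ⟨i, hi⟩ := Function.ne_iff.mp hd0
    exact ⟨i, Nat.pos_of_ne_zero hi⟩
  obtain ⟨j, hj, hmin⟩ :=
    (Set.toFinite {i | 0 < d i}).exists_minimalFor (fun i => ξ i - 2 * (d i : ℤ)) _ hne
  have hlowest : ∀ k, 0 < d k → ξ j - 2 * (d j : ℤ) ≤ ξ k - 2 * (d k : ℤ) := fun k hk =>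
    (le_total _ _).elim id (hmin hk)
  replace hj : 0 < d j := hj
  refine ⟨j, hj, fun k hk => (hd j k hk).resolve_left fun h => ?_,
    fun k hk => (hd k j hk).resolve_right fun h => ?_⟩
  all_goals
    have := hlowest k (by omega)
    have := hξ _ _ hk
    omega

variable [DecidableEq I]

theorem IsSlice.exists_eq_flip [Finite I] (hξ : IsHeightFunction Q ξ) {d : I → ℕ}
    (hd : IsSlice Q d) (hd0 : d ≠ 0) :
    ∃ d' j, IsSlice Q d' ∧ IsSliceSource Q d' j ∧ d = d' + Pi.single j 1 := by
  obtain ⟨j, hj, hout, hin⟩ := hd.exists_sink hξ hd0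
  have hloop : ∀ i, ¬ Q i i := fun i h => by
    have := hξ _ _ h
    omega
  obtain ⟨d', rfl⟩ : ∃ d' : I → ℕ, d = d' + Pi.single j 1 := by
    refine ⟨d - Pi.single j 1, (tsub_add_cancel_of_le fun k => ?_).symm⟩
    rcases eq_or_ne k j with rfl | hk
    · simpa using Nat.one_le_iff_ne_zero.mpr hj.ne'
    · simp [hk]
  have hdj : (d' + Pi.single j 1 : I → ℕ) j = d' j + 1 := by simp
  have hdk : ∀ k, k ≠ j → (d' + Pi.single j 1 : I → ℕ) k = d' k := fun k hk => by simp [hk]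
  have hout' : ∀ k, Q j k → d' k = d' j := fun k hk => by
    have := hout k hk
    rw [hdj, hdk k fun h => hloop j (h ▸ hk)] at this
    omega
  have hin' : ∀ k, Q k j → d' k = d' j + 1 := fun k hk => by
    have := hin k hk
    rw [hdj, hdk k fun h => hloop j (h ▸ hk)] at this
    exact this.symm
  refine ⟨d', j, fun a b hab => ?_, ⟨hout', hin'⟩, rfl⟩
  rcases eq_or_ne a j with rfl | ha
  · exact Or.inl (hout' b hab)
  rcases eq_or_ne b j with rfl | hb
  · exact Or.inr (hin' a hab)
  · simpa only [hdk a ha, hdk b hb] using hd a b hab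

theorem IsSlice.induction [Finite I] (hξ : IsHeightFunction Q ξ) {P : (I → ℕ) → Prop} (zero : P 0)
    (flip : ∀ d j, IsSlice Q d → IsSliceSource Q d j → P d → P (d + Pi.single j 1)) {d : I → ℕ}
    (hd : IsSlice Q d) : P d := by
  have := Fintype.ofFinite I
  induction hn : ∑ i, d i using Nat.strong_induction_on generalizing d with
  | _ n ih =>
    rcases eq_or_ne d 0 with rfl | hd0
    · exact zero
    obtain ⟨d', j, hd', hj, rfl⟩ := hd.exists_eq_flip hξ hd0
    refine flip d' j hd' hj (ih _ ?_ hd' rfl)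
    rw [← hn]
    simp [Finset.sum_add_distrib]

end Slices

section OrbitRoots

variable {I : Type*} [Fintype I] [DecidableEq I] {D : SimplyLacedCartan I} {Q : I → I → Prop}
  {ξ : I → ℤ} {τ : (I → ℤ) ≃ₗ[ℤ] (I → ℤ)}

theorem IsCoxeterTransformation.eulerBilin_orbitRoot_succ (hτ : IsCoxeterTransformation Q τ)
    (j : I) (r : ℕ) (x : I → ℤ) :
    eulerBilin Q x (orbitRoot Q τ j (r + 1)) = -eulerBilin Q (orbitRoot Q τ j r) x := by
  rw [orbitRoot_succ, hτ]

theorem gammaRoot_add_coxeter_gammaRoot (hQ : IsOrientation D Q) (hξ : IsHeightFunction Q ξ)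
    (hτ : IsCoxeterTransformation Q τ) (j : I) :
    gammaRoot Q j + τ (gammaRoot Q j) = ∑ k, arrowMatrix Q j k • gammaRoot Q k
      + ∑ k, arrowMatrix Q k j • τ (gammaRoot Q k) := by
  refine eulerBilin_right_ext hQ fun x => ?_
  have hγ := congrArg (fun y => eulerBilin Q y x) (gammaRoot_eq_add hQ hξ j)
  simp only [map_add, map_sum, map_smul, LinearMap.add_apply, LinearMap.sum_apply,
    LinearMap.smul_apply, eulerBilin_simpleRoot_left, Matrix.mulVec, dotProduct,
    smul_eq_mul] at hγ
  simp only [map_add, map_sum, map_smul, hτ _ x, eulerBilin_gammaRoot hQ hξ, smul_eq_mul, mul_neg,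
    Finset.sum_neg_distrib]
  omega

theorem orbitRoot_mesh (hQ : IsOrientation D Q) (hξ : IsHeightFunction Q ξ)
    (hτ : IsCoxeterTransformation Q τ) (j : I) (r : ℕ) :
    orbitRoot Q τ j r + orbitRoot Q τ j (r + 1)
      = ∑ k, arrowMatrix Q j k • orbitRoot Q τ k r
        + ∑ k, arrowMatrix Q k j • orbitRoot Q τ k (r + 1) := by
  induction r with
  | zero => exact gammaRoot_add_coxeter_gammaRoot hQ hξ hτ j
  | succ r ih => simpa only [map_add, map_sum, map_smul, ← orbitRoot_succ] using congrArg τ ih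

theorem IsSliceSource.orbitRoot_mesh (hQ : IsOrientation D Q) (hξ : IsHeightFunction Q ξ)
    (hτ : IsCoxeterTransformation Q τ) {d : I → ℕ} {j : I} (hj : IsSliceSource Q d j) :
    orbitRoot Q τ j (d j) + orbitRoot Q τ j (d j + 1)
      = ∑ k, D.adj j k • orbitRoot Q τ k (d k) := by
  have hout : ∀ k, arrowMatrix Q j k • orbitRoot Q τ k (d j)
      = arrowMatrix Q j k • orbitRoot Q τ k (d k) := fun k =>
    arrowMatrix_smul_congr fun hk => by rw [hj.1 k hk]
  have hin : ∀ k, arrowMatrix Q k j • orbitRoot Q τ k (d j + 1)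
      = arrowMatrix Q k j • orbitRoot Q τ k (d k) := fun k =>
    arrowMatrix_smul_congr fun hk => by rw [hj.2 k hk]
  simp only [HL.orbitRoot_mesh hQ hξ hτ, hout, hin, adj_eq_add_transpose hQ, Matrix.add_apply,
    Matrix.transpose_apply, add_smul, Finset.sum_add_distrib]

/-- The coordinates of a vector in the system of simple roots attached to the slice `d`; the
`i`-th coordinate is read off by pairing with `τ^(d i) γ_i`. -/
def sliceCoord (Q : I → I → Prop) (τ : (I → ℤ) ≃ₗ[ℤ] (I → ℤ)) (d : I → ℕ) :
    (I → ℤ) →ₗ[ℤ] (I → ℤ) :=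
  LinearMap.pi fun i => (eulerBilin Q).flip (orbitRoot Q τ i (d i))

theorem sliceCoord_apply (Q : I → I → Prop) (τ : (I → ℤ) ≃ₗ[ℤ] (I → ℤ)) (d : I → ℕ)
    (x : I → ℤ) (i : I) : sliceCoord Q τ d x i = eulerBilin Q x (orbitRoot Q τ i (d i)) :=
  rfl

theorem sliceCoord_zero (hQ : IsOrientation D Q) (hξ : IsHeightFunction Q ξ) (x : I → ℤ) :
    sliceCoord Q τ 0 x = x :=
  funext fun i => eulerBilin_gammaRoot hQ hξ x i

theorem IsSliceSource.sliceCoord_flip (hQ : IsOrientation D Q) (hξ : IsHeightFunction Q ξ)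
    (hτ : IsCoxeterTransformation Q τ) {d : I → ℕ} {j : I} (hj : IsSliceSource Q d j)
    (x : I → ℤ) :
    sliceCoord Q τ (d + Pi.single j 1) x = simpleReflection D j (sliceCoord Q τ d x) := by
  ext i
  rcases eq_or_ne i j with rfl | hi
  · have hmesh := congrArg (eulerBilin Q x) (hj.orbitRoot_mesh hQ hξ hτ)
    simp only [map_add, map_sum, map_smul, smul_eq_mul] at hmesh
    rw [simpleReflection_apply_self_eq_adj, eq_sub_iff_add_eq', sliceCoord_apply, sliceCoord_apply,
      Pi.add_apply, Pi.single_eq_same, hmesh]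
    rfl
  · rw [simpleReflection_apply_of_ne D hi, sliceCoord_apply, sliceCoord_apply, Pi.add_apply,
      Pi.single_eq_of_ne hi, add_zero]

theorem IsSlice.exists_sliceCoord_eq_weyl (hQ : IsOrientation D Q) (hξ : IsHeightFunction Q ξ)
    (hτ : IsCoxeterTransformation Q τ) {d : I → ℕ} (hd : IsSlice Q d) :
    ∃ w ∈ weylGroup D, ∀ x, sliceCoord Q τ d x = w x := by
  refine hd.induction hξ (P := fun d => ∃ w ∈ weylGroup D, ∀ x, sliceCoord Q τ d x = w x)
    ⟨1, one_mem _, sliceCoord_zero hQ hξ⟩ fun d j _ hj ⟨w, hw, hdw⟩ =>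
      ⟨simpleReflection D j * w, mul_mem (simpleReflection_mem_weylGroup D j) hw, fun x => ?_⟩
  rw [hj.sliceCoord_flip hQ hξ hτ, hdw, LinearEquiv.mul_apply]

theorem IsSlice.sliceCoord_mem_roots (hQ : IsOrientation D Q) (hξ : IsHeightFunction Q ξ)
    (hτ : IsCoxeterTransformation Q τ) {d : I → ℕ} (hd : IsSlice Q d) {x : I → ℤ}
    (hx : x ∈ roots D) : sliceCoord Q τ d x ∈ roots D := by
  obtain ⟨w, hw, hdw⟩ := hd.exists_sliceCoord_eq_weyl hQ hξ hτ
  obtain ⟨v, hv, i, rfl⟩ := hx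
  exact ⟨w * v, mul_mem hw hv, i, hdw _⟩

theorem IsSliceSource.simpleRoot_form_sliceCoord (hQ : IsOrientation D Q)
    (hξ : IsHeightFunction Q ξ) (hτ : IsCoxeterTransformation Q τ) {d : I → ℕ} {j : I}
    (hj : IsSliceSource Q d j) (x : I → ℤ) :
    (simpleRoot j : I → ℤ) ⬝ᵥ D.C *ᵥ sliceCoord Q τ d x
      = orbitRoot Q τ j (d j) ⬝ᵥ D.C *ᵥ x := by
  have hflip := congrFun (hj.sliceCoord_flip hQ hξ hτ x) j
  rw [simpleReflection_apply_self, sliceCoord_apply, sliceCoord_apply, Pi.add_apply,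
    Pi.single_eq_same, hτ.eulerBilin_orbitRoot_succ] at hflip
  rw [simpleRoot, single_one_dotProduct, form_eq_eulerBilin_add hQ]
  omega

theorem IsSlice.sliceCoord_orbitRoot_of_source (hQ : IsOrientation D Q)
    (hξ : IsHeightFunction Q ξ) (hτ : IsCoxeterTransformation Q τ) {d : I → ℕ} (hd : IsSlice Q d)
    {j : I} (hj : IsSliceSource Q d j) :
    sliceCoord Q τ d (orbitRoot Q τ j (d j)) = simpleRoot j := by
  obtain ⟨w, hw, hdw⟩ := hd.exists_sliceCoord_eq_weyl hQ hξ hτ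
  refine form_left_ext D fun y => ?_
  obtain ⟨x, rfl⟩ := w.surjective y
  rw [← hdw x, hj.simpleRoot_form_sliceCoord hQ hξ hτ, hdw, hdw, form_weyl_apply_apply D hw]

theorem orbitRoot_mem_roots (hQ : IsOrientation D Q) (hξ : IsHeightFunction Q ξ)
    (hτ : IsCoxeterTransformation Q τ) (j : I) (r : ℕ) : orbitRoot Q τ j r ∈ roots D := by
  have hd := isSlice_heightSlice hξ (ξ j - 2 * r)
  obtain ⟨w, hw, hdw⟩ := hd.exists_sliceCoord_eq_weyl hQ hξ hτ
  have hsource := hd.sliceCoord_orbitRoot_of_source hQ hξ hτ (isSliceSource_heightSlice hξ j r)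
  rw [heightSlice_self, hdw] at hsource
  exact ⟨w⁻¹, inv_mem hw, j, (w.symm_apply_eq.mpr hsource.symm).symm⟩

end OrbitRoots

section SignCount

variable {I : Type*}

open Classical in
/-- `1` if `x` has a negative coordinate and `0` otherwise; on a root it distinguishes the
negative roots from the positive ones. -/
def negIndicator (x : I → ℤ) : ℤ := if 0 ≤ x then 0 else 1

variable [Fintype I]

/-- The sign `ε` with `x = ε y`, and `0` if `x ≠ ±y`. -/
def matchSign (x y : I → ℤ) : ℤ := if x = y then 1 else if x = -y then -1 else 0

theorem matchSign_map (w : (I → ℤ) ≃ₗ[ℤ] (I → ℤ)) (x y : I → ℤ) :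
    matchSign (w x) (w y) = matchSign x y := by
  simp only [matchSign, ← map_neg, w.injective.eq_iff]

theorem matchSign_smul (x y : I → ℤ) :
    matchSign x y • y = if x = y ∨ x = -y then x else 0 := by
  unfold matchSign
  split_ifs <;> simp_all

variable [DecidableEq I] {D : SimplyLacedCartan I} {Q : I → I → Prop} {ξ : I → ℤ}
  {τ : (I → ℤ) ≃ₗ[ℤ] (I → ℤ)}

theorem simpleReflection_nonneg_iff {x : I → ℤ} (hx : x ⬝ᵥ D.C *ᵥ x = 2) {j : I}
    (hj : x ≠ simpleRoot j) (hj' : x ≠ -simpleRoot j) : 0 ≤ simpleReflection D j x ↔ 0 ≤ x := by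
  refine ⟨fun h => ?_, fun h => simpleReflection_nonneg D hx h hj⟩
  have hne : simpleReflection D j x ≠ simpleRoot j := fun heq => hj' <| by
    rw [← (simpleReflection D j).injective.eq_iff, heq, map_neg, simpleReflection,
      Module.reflection_apply_self, neg_neg]
  simpa only [simpleReflection, Module.involutive_reflection (coroot_simpleRoot D j) x] using
    simpleReflection_nonneg D ((form_reflection D j x).trans hx) h hne

theorem negIndicator_simpleReflection {x : I → ℤ} (hx : x ⬝ᵥ D.C *ᵥ x = 2) (j : I) :
    negIndicator (simpleReflection D j x) = negIndicator x + matchSign (simpleRoot j) x := by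
  have hpos : (0 : I → ℤ) ≤ simpleRoot j := Pi.single_nonneg.mpr zero_le_one
  have hneg : ¬ (0 : I → ℤ) ≤ -simpleRoot j := fun h => by simpa [simpleRoot] using h j
  have hself : simpleReflection D j (simpleRoot j) = -simpleRoot j :=
    Module.reflection_apply_self (coroot_simpleRoot D j)
  unfold matchSign
  split_ifs with h h'
  · simp [negIndicator, ← h, hself, hpos, hneg]
  · rw [← neg_eq_iff_eq_neg, eq_comm] at h'
    simp [negIndicator, h', hself, hpos, hneg]
  · rw [negIndicator, simpleReflection_nonneg_iff hx (Ne.symm h) fun heq => h' (by simp [heq]),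
      add_zero, negIndicator]

theorem IsSliceSource.matchSign_orbitRoot (hQ : IsOrientation D Q) (hξ : IsHeightFunction Q ξ)
    (hτ : IsCoxeterTransformation Q τ) {d : I → ℕ} {j : I} (hd : IsSlice Q d)
    (hj : IsSliceSource Q d j) (x : I → ℤ) :
    matchSign (orbitRoot Q τ j (d j)) x = matchSign (simpleRoot j) (sliceCoord Q τ d x) := by
  obtain ⟨w, _, hdw⟩ := hd.exists_sliceCoord_eq_weyl hQ hξ hτ
  rw [← hd.sliceCoord_orbitRoot_of_source hQ hξ hτ hj, hdw, hdw, matchSign_map]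

theorem sum_range_add_single {M : Type*} [AddCommMonoid M] (f : I → ℕ → M) (d : I → ℕ) (j : I) :
    ∑ i, ∑ r ∈ Finset.range (((d + Pi.single j 1 : I → ℕ) i)), f i r
      = ∑ i, ∑ r ∈ Finset.range (d i), f i r + f j (d j) := by
  have hterm : ∀ i, ∑ r ∈ Finset.range (((d + Pi.single j 1 : I → ℕ) i)), f i r
      = ∑ r ∈ Finset.range (d i), f i r + if i = j then f j (d j) else 0 := fun i => by
    rcases eq_or_ne i j with rfl | hi
    · simp [Finset.sum_range_succ]
    · simp [hi]
  simp only [hterm, Finset.sum_add_distrib, Finset.sum_ite_eq', Finset.mem_univ, if_true]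

theorem IsSlice.sum_matchSign_orbitRoot (hQ : IsOrientation D Q) (hξ : IsHeightFunction Q ξ)
    (hτ : IsCoxeterTransformation Q τ) {d : I → ℕ} (hd : IsSlice Q d) {β : I → ℤ}
    (hβ : β ∈ posRoots D) :
    ∑ j, ∑ r ∈ Finset.range (d j), matchSign (orbitRoot Q τ j r) β
      = negIndicator (sliceCoord Q τ d β) := by
  refine hd.induction hξ (P := fun d => ∑ j, ∑ r ∈ Finset.range (d j),
    matchSign (orbitRoot Q τ j r) β = negIndicator (sliceCoord Q τ d β)) ?_
      fun d j hd hj ih => ?_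
  · have h0 : 0 ≤ β := hβ.2
    simp [sliceCoord_zero hQ hξ, negIndicator, h0]
  · have hform := form_root D (hd.sliceCoord_mem_roots hQ hξ hτ hβ.1)
    rw [sum_range_add_single, ih, hj.sliceCoord_flip hQ hξ hτ, negIndicator_simpleReflection hform,
      hj.matchSign_orbitRoot hQ hξ hτ hd]

end SignCount

section EulerValues

variable {I : Type*} [Fintype I] [DecidableEq I] {D : SimplyLacedCartan I} {Q : I → I → Prop}
  {ξ : I → ℤ} {τ : (I → ℤ) ≃ₗ[ℤ] (I → ℤ)}

theorem eulerBilin_orbitRoot_heightSlice (hQ : IsOrientation D Q) (hξ : IsHeightFunction Q ξ)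
    (hτ : IsCoxeterTransformation Q τ) (i : I) (a : ℕ) (j : I) :
    eulerBilin Q (orbitRoot Q τ i a) (orbitRoot Q τ j (heightSlice ξ (ξ i - 2 * a) j))
      = if i = j then 1 else 0 := by
  have hsource := (isSlice_heightSlice hξ _).sliceCoord_orbitRoot_of_source hQ hξ hτ
    (isSliceSource_heightSlice hξ i a)
  rw [heightSlice_self] at hsource
  rw [← sliceCoord_apply, hsource, simpleRoot, Pi.single_apply]
  simp only [eq_comm]

theorem cTilde_eq_eulerBilin_orbitRoot (hQ : IsOrientation D Q) (hξ : IsHeightFunction Q ξ)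
    (hτ : IsCoxeterTransformation Q τ) {i j : I} {a r m : ℕ}
    (h : ξ j - 2 * (r : ℤ) = ξ i - 2 * (a : ℤ) + m - 1) :
    cTilde D i j m = eulerBilin Q (orbitRoot Q τ i a) (orbitRoot Q τ j r) := by
  induction m using Nat.twoStepInduction generalizing j r with
  | zero =>
    have hj : heightSlice ξ (ξ i - 2 * a) j = r := by unfold heightSlice; omega
    have hij : i ≠ j := by
      rintro rfl
      omega
    rw [← hj, eulerBilin_orbitRoot_heightSlice hQ hξ hτ, if_neg hij, Nat.cast_zero,
      cTilde_of_nonpos D i j le_rfl]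
  | one =>
    have hj : heightSlice ξ (ξ i - 2 * a) j = r := by unfold heightSlice; omega
    rw [← hj, eulerBilin_orbitRoot_heightSlice hQ hξ hτ, Nat.cast_one, cTilde_one]
  | more m ih₀ ih₁ =>
    push_cast at h
    have hsource := isSliceSource_heightSlice hξ j r
    set d := heightSlice ξ (ξ j - 2 * r) with hd
    have hneighbours : ∀ k, D.adj j k * cTilde D i k (m + 1)
        = D.adj j k * eulerBilin Q (orbitRoot Q τ i a) (orbitRoot Q τ k (d k)) := fun k => by
      by_cases hjk : D.adj j k = 0
      · rw [hjk, zero_mul, zero_mul]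
      have hk : ξ k - 2 * (d k : ℤ) = ξ j - 2 * r - 1 := by
        rw [hd]
        unfold heightSlice
        rcases adjacent_of_adj_ne_zero hQ hjk with h' | h' <;>
        · have := hξ _ _ h'
          omega
      rw [← ih₁ (j := k) (r := d k) (by push_cast; omega), Nat.cast_succ]
    have hrec := cTilde_recursion D i j (m + 1)
    have hmesh := congrArg (eulerBilin Q (orbitRoot Q τ i a)) (hsource.orbitRoot_mesh hQ hξ hτ)
    simp only [map_add, map_sum, map_smul, smul_eq_mul, hd, heightSlice_self] at hmesh
    rw [if_neg (by omega), Finset.sum_congr rfl fun k _ => hneighbours k, hd, ← hmesh,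
      add_sub_cancel_right, ih₀ (j := j) (r := r + 1) (by push_cast; omega)] at hrec
    have hm : ((m + 2 : ℕ) : ℤ) = m + 1 + 1 := by
      push_cast
      ring
    rw [hm]
    linarith

end EulerValues

section Values

variable {I : Type*} {ξ : I → ℤ}

theorem prod_zpow_eq_zpow_sum {G ι : Type*} [CommGroup G] (g : G) (s : Finset ι) (f : ι → ℤ) :
    ∏ i ∈ s, g ^ f i = g ^ ∑ i ∈ s, f i :=
  (map_prod (zpowersHom G g) (fun i => Multiplicative.ofAdd (f i)) s).symm

theorem IndexSet.pos_mk (ξ : I → ℤ) (i : I) (k : ℕ) : (IndexSet.mk ξ i k).pos = ξ i - 2 * k :=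
  rfl

theorem IndexSet.pos_eq (q : IndexSet ξ) : q.pos = ξ q.vertex - 2 * q.depth := by
  rw [← IndexSet.pos_mk, q.mk_depth]

/-- The parametrisation of `I^{≤ξ}` by vertices and depths. -/
def IndexSet.equivSigma (ξ : I → ℤ) : (Σ _ : I, ℕ) ≃ IndexSet ξ where
  toFun x := IndexSet.mk ξ x.1 x.2
  invFun q := ⟨q.vertex, q.depth⟩
  left_inv x := Sigma.ext rfl (heq_of_eq (IndexSet.depth_mk ξ x.1 x.2))
  right_inv q := q.mk_depth

variable [Fintype I]

/-- The elements `(j, s)` of `I^{≤ξ}` with `p < s`. -/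
def IndexSet.above (ξ : I → ℤ) (p : ℤ) : Finset (IndexSet ξ) :=
  (Finset.univ.sigma fun j => Finset.range (heightSlice ξ p j)).map (equivSigma ξ).toEmbedding

theorem IndexSet.mem_above {p : ℤ} {r : IndexSet ξ} : r ∈ above ξ p ↔ p < r.pos := by
  rw [above, Finset.mem_map_equiv, Finset.mem_sigma, Finset.mem_range, lt_heightSlice_iff, pos_eq]
  exact and_iff_right (Finset.mem_univ _)

theorem IndexSet.sum_above {M : Type*} [AddCommMonoid M] (p : ℤ) (f : IndexSet ξ → M) :
    ∑ r ∈ above ξ p, f r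
      = ∑ j, ∑ n ∈ Finset.range (heightSlice ξ p j), f (IndexSet.mk ξ j n) := by
  rw [above, Finset.sum_map, Finset.sum_sigma]
  rfl

variable [DecidableEq I] {D : SimplyLacedCartan I} {Q : I → I → Prop}
  {τ : (I → ℤ) ≃ₗ[ℤ] (I → ℤ)}

theorem neg_notMem_posRoots {x : I → ℤ} (hx : x ∈ posRoots D) : -x ∉ posRoots D := fun hneg => by
  have h0 : x = 0 := le_antisymm (fun i => neg_nonneg.mp (hneg.2 i)) hx.2
  simpa [h0] using form_root D hx.1

theorem betaSeq_eq_or_eq_neg (D : SimplyLacedCartan I) (Q : I → I → Prop)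
    (τ : (I → ℤ) ≃ₗ[ℤ] (I → ℤ)) (j : I) (r : ℕ) :
    betaSeq D Q τ j r = orbitRoot Q τ j r ∨ betaSeq D Q τ j r = -orbitRoot Q τ j r := by
  induction r with
  | zero => exact Or.inl rfl
  | succ r ih =>
    rw [betaSeq, orbitRoot_succ]
    rcases ih with h | h <;> rw [h] <;> split_ifs <;> simp

theorem betaSeq_mem_posRoots (hQ : IsOrientation D Q) (hξ : IsHeightFunction Q ξ)
    (hτ : IsCoxeterTransformation Q τ) (j : I) (r : ℕ) : betaSeq D Q τ j r ∈ posRoots D := by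
  cases r with
  | zero => exact ⟨orbitRoot_mem_roots hQ hξ hτ j 0, gammaRoot_nonneg j⟩
  | succ r =>
    have hroot : τ (betaSeq D Q τ j r) ∈ roots D := by
      have horbit := orbitRoot_mem_roots hQ hξ hτ j (r + 1)
      rw [orbitRoot_succ] at horbit
      rcases betaSeq_eq_or_eq_neg D Q τ j r with h | h <;> rw [h]
      · exact horbit
      · rw [map_neg]
        exact neg_mem_roots D horbit
    rw [betaSeq]
    split_ifs with h
    · exact h
    · exact (mem_posRoots_or_neg_mem_posRoots D hroot).resolve_left h

theorem betaSeq_eq_iff (hQ : IsOrientation D Q) (hξ : IsHeightFunction Q ξ)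
    (hτ : IsCoxeterTransformation Q τ) {β : I → ℤ} (hβ : β ∈ posRoots D) (j : I) (r : ℕ) :
    betaSeq D Q τ j r = β ↔ orbitRoot Q τ j r = β ∨ orbitRoot Q τ j r = -β := by
  have hpos := betaSeq_mem_posRoots hQ hξ hτ j r
  have hne : betaSeq D Q τ j r ≠ -β := fun h => neg_notMem_posRoots hβ (h ▸ hpos)
  rcases betaSeq_eq_or_eq_neg D Q τ j r with h | h
  · rw [h] at hne ⊢
    exact ⟨Or.inl, fun h' => h'.resolve_right hne⟩
  · rw [h] at hne ⊢
    rw [neg_eq_iff_eq_neg]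
    exact ⟨Or.inr, fun h' => h'.resolve_left fun heq => hne (congrArg Neg.neg heq)⟩

theorem cTilde_pos_sub_pos (hQ : IsOrientation D Q) (hξ : IsHeightFunction Q ξ)
    (hτ : IsCoxeterTransformation Q τ) {q r : IndexSet ξ} (hqr : q.pos - 1 < r.pos) :
    cTilde D q.vertex r.vertex (r.pos - q.pos + 1)
      = eulerBilin Q (orbitRoot Q τ q.vertex q.depth) (orbitRoot Q τ r.vertex r.depth) := by
  obtain ⟨m, hm⟩ := Int.eq_ofNat_of_zero_le (a := r.pos - q.pos + 1) (by omega)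
  rw [hm]
  refine cTilde_eq_eulerBilin_orbitRoot hQ hξ hτ ?_
  rw [← r.pos_eq, ← q.pos_eq]
  omega

theorem dTildeY_eq_prod (D : SimplyLacedCartan I) (Q : I → I → Prop)
    (τ : (I → ℤ) ≃ₗ[ℤ] (I → ℤ)) {q : IndexSet ξ} {p : ℤ} (hp : p < q.pos) :
    dTildeY D Q τ q = ∏ r ∈ IndexSet.above ξ p, betaUnit D Q τ r ^
      (cTilde D q.vertex r.vertex (r.pos - q.pos - 1)
        - cTilde D q.vertex r.vertex (r.pos - q.pos + 1)) := by
  refine finprod_eq_prod_of_mulSupport_subset _ fun r hr => ?_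
  rw [SetLike.mem_coe, IndexSet.mem_above]
  contrapose! hr
  rw [Function.notMem_mulSupport, cTilde_of_nonpos D _ _ (by omega),
    cTilde_of_nonpos D _ _ (by omega), sub_zero, zpow_zero]

theorem prod_dTildeY (hQ : IsOrientation D Q) (hξ : IsHeightFunction Q ξ)
    (τ : (I → ℤ) ≃ₗ[ℤ] (I → ℤ)) (q : IndexSet ξ) :
    ∏ l ∈ Finset.range (q.depth + 1), dTildeY D Q τ (IndexSet.mk ξ q.vertex l)
      = ∏ r ∈ IndexSet.above ξ (q.pos - 1),
          betaUnit D Q τ r ^ (-cTilde D q.vertex r.vertex (r.pos - q.pos + 1)) := by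
  let u (r : IndexSet ξ) (l : ℕ) : ℤ :=
    cTilde D q.vertex r.vertex (r.pos - ξ q.vertex + 2 * (l : ℤ) - 1)
  have hfactor : ∀ l ∈ Finset.range (q.depth + 1), dTildeY D Q τ (IndexSet.mk ξ q.vertex l)
      = ∏ r ∈ IndexSet.above ξ (q.pos - 1), betaUnit D Q τ r ^ (u r l - u r (l + 1)) := by
    intro l hl
    rw [Finset.mem_range] at hl
    rw [dTildeY_eq_prod D Q τ (p := q.pos - 1) (by rw [IndexSet.pos_mk, q.pos_eq]; omega)]
    refine Finset.prod_congr rfl fun r _ => ?_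
    simp only [u, IndexSet.pos_mk]
    congr 3 <;> push_cast <;> ring
  rw [Finset.prod_congr rfl hfactor, Finset.prod_comm]
  refine Finset.prod_congr rfl fun r _ => ?_
  have hfirst : u r 0 = 0 :=
    cTilde_eq_zero_of_lt_height_sub hQ hξ (by rw [r.pos_eq]; push_cast; omega)
  have hlast : u r (q.depth + 1) = cTilde D q.vertex r.vertex (r.pos - q.pos + 1) := by
    simp only [u, q.pos_eq]
    congr 1
    push_cast
    ring
  rw [prod_zpow_eq_zpow_sum, Finset.sum_range_sub', hfirst, hlast, zero_sub]

theorem beta_mem_posRoots (hQ : IsOrientation D Q) (hξ : IsHeightFunction Q ξ)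
    (hτ : IsCoxeterTransformation Q τ) (q : IndexSet ξ) : beta D Q τ q ∈ posRoots D :=
  betaSeq_mem_posRoots hQ hξ hτ q.vertex q.depth

theorem prod_betaUnit_zpow (hQ : IsOrientation D Q) (hξ : IsHeightFunction Q ξ)
    (hτ : IsCoxeterTransformation Q τ) (s : Finset (IndexSet ξ)) (e : IndexSet ξ → ℤ) :
    ((∏ r ∈ s, betaUnit D Q τ r ^ e r : (RootField I)ˣ) : RootField I)
      = ∏ β : posRoots D, toField (β : I → ℤ) ^ ∑ r ∈ s with beta D Q τ r = β, e r := by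
  classical
  let root (r : IndexSet ξ) : posRoots D := ⟨beta D Q τ r, beta_mem_posRoots hQ hξ hτ r⟩
  rw [← Finset.prod_fiberwise s root, Units.coe_prod]
  refine Finset.prod_congr rfl fun β _ => ?_
  have hβ : (β : I → ℤ) ≠ 0 := fun h => by simpa [h] using form_root D β.2.1
  have hunit : ∀ r ∈ s.filter (root · = β),
      betaUnit D Q τ r ^ e r = Units.mk0 _ (toField_ne_zero hβ) ^ e r := fun r hr => by
    have hr : beta D Q τ r = β := congrArg Subtype.val (Finset.mem_filter.mp hr).2
    simp only [betaUnit, hr]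
  rw [Finset.prod_congr rfl hunit, prod_zpow_eq_zpow_sum, Units.val_zpow_eq_zpow_val,
    Units.val_mk0]
  simp only [root, Subtype.ext_iff]

theorem sum_cTilde_filter_beta_eq (hQ : IsOrientation D Q) (hξ : IsHeightFunction Q ξ)
    (hτ : IsCoxeterTransformation Q τ) (q : IndexSet ξ) {β : I → ℤ} (hβ : β ∈ posRoots D) :
    ∑ r ∈ IndexSet.above ξ (q.pos - 1) with beta D Q τ r = β,
        cTilde D q.vertex r.vertex (r.pos - q.pos + 1)
      = negIndicator (sliceCoord Q τ (heightSlice ξ (q.pos - 1)) β)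
          * eulerBilin Q (orbitRoot Q τ q.vertex q.depth) β := by
  have hterm : ∀ r ∈ IndexSet.above ξ (q.pos - 1),
      (if beta D Q τ r = β then cTilde D q.vertex r.vertex (r.pos - q.pos + 1) else 0)
        = matchSign (orbitRoot Q τ r.vertex r.depth) β
            * eulerBilin Q (orbitRoot Q τ q.vertex q.depth) β := fun r hr => by
    rw [← smul_eq_mul, ← map_smul, matchSign_smul, beta,
      cTilde_pos_sub_pos hQ hξ hτ (IndexSet.mem_above.mp hr)]
    simp only [betaSeq_eq_iff hQ hξ hτ hβ]
    split_ifs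
    · rfl
    · exact (map_zero _).symm
  rw [Finset.sum_filter, Finset.sum_congr rfl hterm, ← Finset.sum_mul, IndexSet.sum_above,
    ← (isSlice_heightSlice hξ (q.pos - 1)).sum_matchSign_orbitRoot hQ hξ hτ hβ]
  simp only [IndexSet.depth_mk]
  rfl

theorem abs_eulerForm_beta (D : SimplyLacedCartan I) (Q : I → I → Prop)
    (τ : (I → ℤ) ≃ₗ[ℤ] (I → ℤ)) (q : IndexSet ξ) (β : I → ℤ) :
    |eulerForm Q (beta D Q τ q) β| = |eulerBilin Q (orbitRoot Q τ q.vertex q.depth) β| := by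
  rw [← eulerBilin_eq_eulerForm, beta]
  rcases betaSeq_eq_or_eq_neg D Q τ q.vertex q.depth with h | h <;> simp [h]

theorem sum_cTilde_filter_beta_eq_zero_or (hQ : IsOrientation D Q) (hξ : IsHeightFunction Q ξ)
    (hτ : IsCoxeterTransformation Q τ) (q : IndexSet ξ) {β : I → ℤ} (hβ : β ∈ posRoots D) :
    ∑ r ∈ IndexSet.above ξ (q.pos - 1) with beta D Q τ r = β,
        cTilde D q.vertex r.vertex (r.pos - q.pos + 1) = 0 ∨
      ∑ r ∈ IndexSet.above ξ (q.pos - 1) with beta D Q τ r = β,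
        cTilde D q.vertex r.vertex (r.pos - q.pos + 1) = |eulerForm Q (beta D Q τ q) β| := by
  rw [sum_cTilde_filter_beta_eq hQ hξ hτ q hβ, abs_eulerForm_beta, negIndicator]
  split_ifs with hnonneg
  · exact Or.inl (zero_mul _)
  · refine Or.inr ?_
    have hroot := (isSlice_heightSlice hξ (q.pos - 1)).sliceCoord_mem_roots hQ hξ hτ hβ.1
    have hcoord := (nonneg_or_nonpos_of_form_eq_two D (form_root D hroot)).resolve_left
      hnonneg q.vertex
    have hdepth : heightSlice ξ (q.pos - 1) q.vertex = q.depth + 1 := by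
      rw [heightSlice, q.pos_eq]
      omega
    rw [sliceCoord_apply, hdepth, hτ.eulerBilin_orbitRoot_succ] at hcoord
    rw [one_mul, abs_of_nonneg (neg_nonpos.mp hcoord)]

theorem exists_dTilde_monomialKR_eq (hQ : IsOrientation D Q) (hξ : IsHeightFunction Q ξ)
    (hτ : IsCoxeterTransformation Q τ) (q : IndexSet ξ) :
    ∃ n : posRoots D → ℕ,
      dTilde D Q τ ξ (monomialKR q) = ∏ β : posRoots D, 1 / toField (β : I → ℤ) ^ n β ∧
      ∀ β : posRoots D, n β ≠ 0 → (n β : ℤ) = |eulerForm Q (beta D Q τ q) (β : I → ℤ)| := by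
  let e (β : posRoots D) : ℤ := ∑ r ∈ IndexSet.above ξ (q.pos - 1) with beta D Q τ r = β,
    cTilde D q.vertex r.vertex (r.pos - q.pos + 1)
  have he (β : posRoots D) : e β = 0 ∨ e β = |eulerForm Q (beta D Q τ q) (β : I → ℤ)| :=
    sum_cTilde_filter_beta_eq_zero_or hQ hξ hτ q β.2
  have hcast (β : posRoots D) : ((e β).toNat : ℤ) = e β :=
    Int.toNat_of_nonneg ((he β).elim (·.ge) fun h => h ▸ abs_nonneg _)
  refine ⟨fun β => (e β).toNat, ?_, fun β hβ => ?_⟩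
  · rw [monomialKR, map_prod]
    simp only [dTilde_Y]
    rw [← Units.coe_prod, prod_dTildeY hQ hξ, prod_betaUnit_zpow hQ hξ hτ]
    refine Finset.prod_congr rfl fun β _ => ?_
    rw [Finset.sum_neg_distrib, zpow_neg, one_div, ← zpow_natCast, hcast]
  · rw [hcast]
    exact (he β).resolve_left fun h => hβ (congrArg Int.toNat h)

end Values

end HL

end

theorem proposition6p4_general {I : Type*} [Fintype I] [DecidableEq I]
    (D : HL.SimplyLacedCartan I)
    (Q : I → I → Prop) (hQ : HL.IsOrientation D Q)
    (ξ : I → ℤ) (hξ : HL.IsHeightFunction Q ξ)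
    (c : List I) (hc : HL.IsCoxeterWord Q c) (q : HL.IndexSet ξ) :
    ∃ y : HL.Torus ξ,
      algebraMap (HL.Torus ξ) (FractionRing (HL.Torus ξ)) y
          = HL.iota D ξ (HL.initialVar D ξ q) ∧
      ∃ n : HL.posRoots D → ℕ,
        HL.dTilde D Q (HL.wordProd D c) ξ y
            = ∏ β : HL.posRoots D, 1 / HL.toField (β : I → ℤ) ^ n β ∧
        ∀ β : HL.posRoots D, n β ≠ 0 →
          (n β : ℤ) = |HL.eulerForm Q (HL.beta D Q (HL.wordProd D c) q) (β : I → ℤ)| :=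
  ⟨HL.monomialKR q, (HL.iota_initialVar D ξ q).symm,
    HL.exists_dTilde_monomialKR_eq hQ hξ (hc.isCoxeterTransformation hQ) q⟩

theorem proposition6p4 {I : Type*} [Fintype I] [DecidableEq I] [Nonempty I]
    (D : HL.SimplyLacedCartan I)
    (Q : I → I → Prop) (hQ : HL.IsOrientation D Q)
    (ξ : I → ℤ) (hξ : HL.IsHeightFunction Q ξ)
    (c : List I) (hc : HL.IsCoxeterWord Q c)
    (w : List I) (hw : HL.IsAdaptedLongestWord D Q w)
    (t : ℕ) (ht : 1 ≤ t) :
    ∃ y : HL.Torus ξ,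
      algebraMap (HL.Torus ξ) (FractionRing (HL.Torus ξ)) y
          = HL.iota D ξ (HL.clusterVar D ξ w t) ∧
      ∃ n : HL.posRoots D → ℕ,
        HL.dTilde D Q (HL.wordProd D c) ξ y
            = ∏ β : HL.posRoots D, 1 / HL.toField (β : I → ℤ) ^ n β ∧
        ∀ β : HL.posRoots D, n β ≠ 0 →
          (n β : ℤ)
            = |HL.eulerForm Q (HL.beta D Q (HL.wordProd D c) (HL.phiInv D ξ w t)) (β : I → ℤ)| :=
  proposition6p4_general D Q hQ ξ hξ c hc (HL.phiInv D ξ w t)
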